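/- Let $\alpha\ge 2$ be a real number. Define $$\mathrm{L}_\alpha(\mathbb{R}^2):=\Big\{u\in \mathrm{W}^{1,2}_{loc}(\mathbb{R}^2)\ :\ \|u\|_{\mathrm{L}_\alpha}:=\Big\|\tfrac{|y|^{(\alpha-2)/2}}{1+|y|^\alpha}\,u\Big\|_{\mathrm{L}^2(\mathbb{R}^2)}<+\infty\Big\}$$ and $$\mathrm{H}_\alpha(\mathbb{R}^2):=\Big\{u\in \mathrm{W}^{1,2}_{loc}(\mathbb{R}^2)\ :\ \|u\|_{\mathrm{H}_\alpha}:=\Big(\|\nabla u\|_{\mathrm{L}^2(\mathbb{R}^2)}^2+\Big\|\tfrac{|y|^{(\alpha-2)/2}}{1+|y|^\alpha}\,u\Big\|_{\mathrm{L}^2(\mathbb{R}^2)}^2\Big)^{1/2}<+\infty\Big\},$$ where $u$ is real-valued, functions that agree almost everywhere are identified, $\nabla u$ is the weak gradient, and the two spaces carry the norms $\|\cdot\|_{\mathrm{L}_\alpha}$ and $\|\cdot\|_{\mathrm{H}_\alpha}$. Then the embedding $i_\alpha:\mathrm{H}_\alpha(\mathbb{R}^2)\hookrightarrow \mathrm{L}_\alpha(\mathbb{R}^2)$,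 $u\mapsto u$, is compact: it maps some neighbourhood of $0$ in $\mathrm{H}_\alpha(\mathbb{R}^2)$ into a compact subset of $\mathrm{L}_\alpha(\mathbb{R}^2)$. -/

import Mathlib

open MeasureTheory
open scoped ContDiff

namespace WeightedSobolev

noncomputable section

/-- The Euclidean plane `ℝ²`. -/
abbrev Plane : Type := EuclideanSpace ℝ (Fin 2)

/-- `f ∈ L²_loc(ℝ²)`: `f` is square integrable on every compact set. -/
def MemL2Loc {F : Type*} [NormedAddCommGroup F] (f : Plane → F) : Prop :=
  ∀ K : Set Plane, IsCompact K → MemLp f 2 (volume.restrict K)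

/-- `g` is a weak (distributional) gradient of `u` on `ℝ²`:
`∫ u ∂ᵢφ = - ∫ gᵢ φ` for every test function `φ ∈ C_c^∞(ℝ²)` and `i = 1, 2`. It is used below
only for `u` and `g` in `L²_loc(ℝ²)`, for which all these integrals converge. -/
def IsWeakGradient (u : Plane → ℝ) (g : Plane → Plane) : Prop :=
  ∀ φ : Plane → ℝ, ContDiff ℝ ∞ φ → HasCompactSupport φ → ∀ i : Fin 2,
    ∫ y, u y * fderiv ℝ φ y (EuclideanSpace.single i 1) = - ∫ y, g y i * φ y

lemma MemL2Loc.congr_ae {F : Type*} [NormedAddCommGroup F] {f g : Plane → F}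
    (hf : MemL2Loc f) (h : f =ᵐ[volume] g) : MemL2Loc g :=
  fun K hK => (hf K hK).ae_eq (ae_restrict_of_ae h)

lemma MemL2Loc.add {F : Type*} [NormedAddCommGroup F] {f g : Plane → F}
    (hf : MemL2Loc f) (hg : MemL2Loc g) : MemL2Loc (fun y => f y + g y) :=
  fun K hK => (hf K hK).add (hg K hK)

lemma MemL2Loc.const_smul {F : Type*} [NormedAddCommGroup F] [NormedSpace ℝ F] {f : Plane → F}
    (c : ℝ) (hf : MemL2Loc f) : MemL2Loc (fun y => c • f y) :=
  fun K hK => (hf K hK).const_smul c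

lemma memL2Loc_zero {F : Type*} [NormedAddCommGroup F] : MemL2Loc (fun _ : Plane => (0 : F)) :=
  fun _ _ => MemLp.zero'

lemma MemL2Loc.locallyIntegrable {F : Type*} [NormedAddCommGroup F] {f : Plane → F}
    (hf : MemL2Loc f) : LocallyIntegrable f volume := by
  rw [locallyIntegrable_iff]
  intro K hK
  have : IsFiniteMeasure (volume.restrict K) := ⟨by simpa using hK.measure_lt_top⟩
  exact (hf K hK).integrable (by norm_num)

lemma MemL2Loc.coord {g : Plane → Plane} (hg : MemL2Loc g) (i : Fin 2) :
    MemL2Loc (fun y => g y i) :=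
  fun K hK => (EuclideanSpace.proj i : Plane →L[ℝ] ℝ).comp_memLp' (hg K hK)

lemma integrable_mul_fderiv {u φ : Plane → ℝ} (hu : MemL2Loc u) (hφ : ContDiff ℝ ∞ φ)
    (hc : HasCompactSupport φ) (v : Plane) :
    Integrable (fun y => u y * fderiv ℝ φ y v) volume :=
  hu.locallyIntegrable.integrable_smul_right_of_hasCompactSupport
    ((hφ.continuous_fderiv (by simp)).clm_apply continuous_const) (hc.fderiv_apply ℝ v)

lemma integrable_coord_mul {g : Plane → Plane} {φ : Plane → ℝ} (hg : MemL2Loc g)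
    (hφ : ContDiff ℝ ∞ φ) (hc : HasCompactSupport φ) (i : Fin 2) :
    Integrable (fun y => g y i * φ y) volume :=
  (hg.coord i).locallyIntegrable.integrable_smul_right_of_hasCompactSupport hφ.continuous hc

lemma IsWeakGradient.congr_ae {u u' : Plane → ℝ} {g g' : Plane → Plane}
    (h : IsWeakGradient u g) (hu : u =ᵐ[volume] u') (hg : g =ᵐ[volume] g') :
    IsWeakGradient u' g' := by
  intro φ hφ hc i
  have h1 : ∫ y, u' y * fderiv ℝ φ y (EuclideanSpace.single i 1)
      = ∫ y, u y * fderiv ℝ φ y (EuclideanSpace.single i 1) :=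
    integral_congr_ae (by filter_upwards [hu] with y hy; rw [hy])
  have h2 : ∫ y, g' y i * φ y = ∫ y, g y i * φ y :=
    integral_congr_ae (by filter_upwards [hg] with y hy; rw [hy])
  rw [h1, h2]
  exact h φ hφ hc i

lemma isWeakGradient_zero : IsWeakGradient (fun _ => 0) (fun _ => 0) := by
  intro φ _ _ i
  simp

lemma IsWeakGradient.add {u v : Plane → ℝ} {g k : Plane → Plane} (hu : MemL2Loc u)
    (hv : MemL2Loc v) (hg : MemL2Loc g) (hk : MemL2Loc k)
    (h : IsWeakGradient u g) (h' : IsWeakGradient v k) :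
    IsWeakGradient (fun y => u y + v y) (fun y => g y + k y) := by
  intro φ hφ hc i
  simp only [PiLp.add_apply, add_mul]
  rw [integral_add (integrable_mul_fderiv hu hφ hc _) (integrable_mul_fderiv hv hφ hc _),
    integral_add (integrable_coord_mul hg hφ hc i) (integrable_coord_mul hk hφ hc i),
    h φ hφ hc i, h' φ hφ hc i]
  ring

lemma IsWeakGradient.const_smul {u : Plane → ℝ} {g : Plane → Plane} (c : ℝ)
    (h : IsWeakGradient u g) : IsWeakGradient (fun y => c • u y) (fun y => c • g y) := by
  intro φ hφ hc i
  simp only [PiLp.smul_apply, smul_eq_mul, mul_assoc, integral_const_mul]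
  rw [h φ hφ hc i]
  ring

lemma IsWeakGradient.unique {u : Plane → ℝ} {g k : Plane → Plane} (hg : MemL2Loc g)
    (hk : MemL2Loc k) (h : IsWeakGradient u g) (h' : IsWeakGradient u k) : g =ᵐ[volume] k := by
  have key : ∀ i : Fin 2, ∀ᵐ y ∂(volume : Measure Plane), g y i = k y i := by
    intro i
    refine ae_eq_of_integral_contDiff_smul_eq (hg.coord i).locallyIntegrable
      (hk.coord i).locallyIntegrable ?_
    intro φ hφ hc
    have e := (h φ hφ hc i).symm.trans (h' φ hφ hc i)
    simpa [mul_comm] using e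
  filter_upwards [ae_all_iff.2 key] with y hy
  ext i
  exact hy i

/-- The Sobolev space `W^{1,2}_loc(ℝ²)`, as a space of almost-everywhere classes of functions. -/
def W12Loc : Submodule ℝ (Plane →ₘ[volume] ℝ) where
  carrier := {u | MemL2Loc u ∧ ∃ g : Plane →ₘ[volume] Plane, MemL2Loc g ∧ IsWeakGradient u g}
  zero_mem' := by
    refine ⟨memL2Loc_zero.congr_ae AEEqFun.coeFn_zero.symm, 0,
      memL2Loc_zero.congr_ae AEEqFun.coeFn_zero.symm,
      isWeakGradient_zero.congr_ae AEEqFun.coeFn_zero.symm AEEqFun.coeFn_zero.symm⟩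
  add_mem' := by
    rintro u v ⟨hu, g, hg, hug⟩ ⟨hv, k, hk, hvk⟩
    exact ⟨(hu.add hv).congr_ae (AEEqFun.coeFn_add u v).symm, g + k,
      (hg.add hk).congr_ae (AEEqFun.coeFn_add g k).symm,
      (hug.add hu hv hg hk hvk).congr_ae (AEEqFun.coeFn_add u v).symm
        (AEEqFun.coeFn_add g k).symm⟩
  smul_mem' := by
    rintro c u ⟨hu, g, hg, hug⟩
    exact ⟨(hu.const_smul c).congr_ae (AEEqFun.coeFn_smul c u).symm, c • g,
      (hg.const_smul c).congr_ae (AEEqFun.coeFn_smul c g).symm,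
      (hug.const_smul c).congr_ae (AEEqFun.coeFn_smul c u).symm (AEEqFun.coeFn_smul c g).symm⟩

/-- The weak gradient `∇u` of `u ∈ W^{1,2}_loc(ℝ²)`; it is unique almost everywhere. -/
def weakGradient (u : W12Loc) : Plane →ₘ[volume] Plane := u.2.2.choose

lemma memL2Loc_weakGradient (u : W12Loc) : MemL2Loc (weakGradient u) := u.2.2.choose_spec.1

lemma isWeakGradient_weakGradient (u : W12Loc) :
    IsWeakGradient (u : Plane →ₘ[volume] ℝ) (weakGradient u) := u.2.2.choose_spec.2

lemma weakGradient_eq (u : W12Loc) {g : Plane → Plane} (hg : MemL2Loc g)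
    (h : IsWeakGradient (u : Plane →ₘ[volume] ℝ) g) : weakGradient u =ᵐ[volume] g :=
  (isWeakGradient_weakGradient u).unique (memL2Loc_weakGradient u) hg h

lemma weakGradient_add (u v : W12Loc) :
    weakGradient (u + v) =ᵐ[volume] fun y => weakGradient u y + weakGradient v y :=
  weakGradient_eq _ ((memL2Loc_weakGradient u).add (memL2Loc_weakGradient v))
    (((isWeakGradient_weakGradient u).add u.2.1 v.2.1 (memL2Loc_weakGradient u)
      (memL2Loc_weakGradient v) (isWeakGradient_weakGradient v)).congr_ae
      (AEEqFun.coeFn_add _ _).symm Filter.EventuallyEq.rfl)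

lemma weakGradient_smul (c : ℝ) (u : W12Loc) :
    weakGradient (c • u) =ᵐ[volume] fun y => c • weakGradient u y :=
  weakGradient_eq _ ((memL2Loc_weakGradient u).const_smul c)
    (((isWeakGradient_weakGradient u).const_smul c).congr_ae
      (AEEqFun.coeFn_smul c (u : Plane →ₘ[volume] ℝ)).symm Filter.EventuallyEq.rfl)

lemma weakGradient_zero : weakGradient 0 =ᵐ[volume] fun _ => 0 :=
  weakGradient_eq _ memL2Loc_zero
    (isWeakGradient_zero.congr_ae AEEqFun.coeFn_zero.symm Filter.EventuallyEq.rfl)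

/-- The weight `|y|^{(α-2)/2} / (1 + |y|^α)`. -/
def weight (α : ℝ) (y : Plane) : ℝ := ‖y‖ ^ ((α - 2) / 2) / (1 + ‖y‖ ^ α)

lemma weight_pos (α : ℝ) {y : Plane} (hy : y ≠ 0) : 0 < weight α y := by
  have : 0 < ‖y‖ := norm_pos_iff.2 hy
  unfold weight
  positivity

/-- The function `y ↦ |y|^{(α-2)/2} / (1 + |y|^α) · u(y)`. -/
def weighted (α : ℝ) (u : W12Loc) (y : Plane) : ℝ :=
  weight α y * (u : Plane →ₘ[volume] ℝ) y

lemma weighted_add (α : ℝ) (u v : W12Loc) :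
    weighted α (u + v) =ᵐ[volume] fun y => weighted α u y + weighted α v y := by
  filter_upwards [AEEqFun.coeFn_add (u : Plane →ₘ[volume] ℝ) v] with y hy
  simp only [weighted, Submodule.coe_add, hy, Pi.add_apply, mul_add]

lemma weighted_smul (α c : ℝ) (u : W12Loc) :
    weighted α (c • u) =ᵐ[volume] fun y => c • weighted α u y := by
  filter_upwards [AEEqFun.coeFn_smul c (u : Plane →ₘ[volume] ℝ)] with y hy
  simp only [weighted, Submodule.coe_smul, hy, Pi.smul_apply, smul_eq_mul]
  ring

lemma weighted_zero (α : ℝ) : weighted α 0 =ᵐ[volume] fun _ => 0 := by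
  filter_upwards [AEEqFun.coeFn_zero (α := Plane) (β := ℝ) (μ := volume)] with y hy
  simp only [weighted, Submodule.coe_zero, hy, Pi.zero_apply, mul_zero]

lemma eq_zero_of_weighted (α : ℝ) (u : W12Loc) (h : weighted α u =ᵐ[volume] fun _ => 0) :
    u = 0 := by
  apply Subtype.ext
  apply AEEqFun.ext
  have h0 : ∀ᵐ y ∂(volume : Measure Plane), y ≠ 0 := by
    simp [ae_iff]
  filter_upwards [h, h0, AEEqFun.coeFn_zero (α := Plane) (β := ℝ) (μ := volume)] with y hy hy0 hz
  have := (mul_eq_zero.1 hy).resolve_left (weight_pos α hy0).ne'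
  rw [this, Submodule.coe_zero, hz, Pi.zero_apply]

/-- The underlying vector space of `L_α(ℝ²)`: the `u ∈ W^{1,2}_loc(ℝ²)` with
`‖ |y|^{(α-2)/2} / (1 + |y|^α) · u ‖_{L²(ℝ²)} < ∞`. -/
def lSubmodule (α : ℝ) : Submodule ℝ W12Loc where
  carrier := {u | MemLp (weighted α u) 2 volume}
  zero_mem' := MemLp.zero'.ae_eq (weighted_zero α).symm
  add_mem' := fun {u v} hu hv => (MemLp.add hu hv).ae_eq (weighted_add α u v).symm
  smul_mem' := fun c u hu => (MemLp.const_smul hu c).ae_eq (weighted_smul α c u).symm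

/-- The underlying vector space of `H_α(ℝ²)`: the `u ∈ W^{1,2}_loc(ℝ²)` with
`‖∇u‖_{L²(ℝ²)} < ∞` and `‖ |y|^{(α-2)/2} / (1 + |y|^α) · u ‖_{L²(ℝ²)} < ∞`. -/
def hSubmodule (α : ℝ) : Submodule ℝ W12Loc where
  carrier := {u | MemLp (weakGradient u) 2 volume ∧ MemLp (weighted α u) 2 volume}
  zero_mem' := ⟨MemLp.zero'.ae_eq weakGradient_zero.symm, (lSubmodule α).zero_mem⟩
  add_mem' := fun {u v} hu hv =>
    ⟨(MemLp.add hu.1 hv.1).ae_eq (weakGradient_add u v).symm, (lSubmodule α).add_mem hu.2 hv.2⟩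
  smul_mem' := fun c u hu =>
    ⟨(MemLp.const_smul hu.1 c).ae_eq (weakGradient_smul c u).symm,
      (lSubmodule α).smul_mem c hu.2⟩

/-- The space `L_α(ℝ²)`. -/
abbrev LSpace (α : ℝ) : Type := lSubmodule α

/-- The space `H_α(ℝ²)`. -/
abbrev HSpace (α : ℝ) : Type := hSubmodule α

/-- The map `u ↦ |y|^{(α-2)/2} / (1 + |y|^α) · u` from `L_α(ℝ²)` to `L²(ℝ²)`. -/
def LSpace.toL2 (α : ℝ) : LSpace α →ₗ[ℝ] Lp ℝ 2 (volume : Measure Plane) where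
  toFun u := MemLp.toLp (weighted α u.1) u.2
  map_add' u v := (MemLp.toLp_congr _ (u.2.add v.2) (weighted_add α u.1 v.1)).trans
    (MemLp.toLp_add u.2 v.2)
  map_smul' c u := (MemLp.toLp_congr _ (u.2.const_smul c) (weighted_smul α c u.1)).trans
    (MemLp.toLp_const_smul c u.2)

lemma LSpace.toL2_injective (α : ℝ) : Function.Injective (LSpace.toL2 α) := by
  rw [injective_iff_map_eq_zero]
  intro u hu
  apply Subtype.ext
  exact eq_zero_of_weighted α u.1 ((MemLp.coeFn_toLp u.2).symm.trans
    ((Lp.eq_zero_iff_ae_eq_zero).1 hu))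

/-- The map `u ↦ (∇u, |y|^{(α-2)/2} / (1 + |y|^α) · u)` from `H_α(ℝ²)` to the Hilbert sum
`L²(ℝ²; ℝ²) ⊕ L²(ℝ²)`. -/
def HSpace.toL2 (α : ℝ) : HSpace α →ₗ[ℝ]
    WithLp 2 (Lp Plane 2 (volume : Measure Plane) × Lp ℝ 2 (volume : Measure Plane)) where
  toFun u := WithLp.toLp 2
    (MemLp.toLp (weakGradient u.1) u.2.1, MemLp.toLp (weighted α u.1) u.2.2)
  map_add' u v := by
    have h1 := (MemLp.toLp_congr (u + v).2.1 (u.2.1.add v.2.1) (weakGradient_add u.1 v.1)).trans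
      (MemLp.toLp_add u.2.1 v.2.1)
    have h2 := (MemLp.toLp_congr (u + v).2.2 (u.2.2.add v.2.2) (weighted_add α u.1 v.1)).trans
      (MemLp.toLp_add u.2.2 v.2.2)
    rw [h1, h2]
    rfl
  map_smul' c u := by
    have h1 := (MemLp.toLp_congr (c • u).2.1 (u.2.1.const_smul c)
      (weakGradient_smul c u.1)).trans (MemLp.toLp_const_smul c u.2.1)
    have h2 := (MemLp.toLp_congr (c • u).2.2 (u.2.2.const_smul c)
      (weighted_smul α c u.1)).trans (MemLp.toLp_const_smul c u.2.2)
    rw [h1, h2]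
    rfl

lemma HSpace.toL2_injective (α : ℝ) : Function.Injective (HSpace.toL2 α) := by
  rw [injective_iff_map_eq_zero]
  intro u hu
  apply Subtype.ext
  have h2 : (HSpace.toL2 α u).snd = 0 :=
    congrArg (fun z : WithLp 2 (Lp Plane 2 (volume : Measure Plane) ×
      Lp ℝ 2 (volume : Measure Plane)) => z.snd) hu
  exact eq_zero_of_weighted α u.1 ((MemLp.coeFn_toLp u.2.2).symm.trans
    ((Lp.eq_zero_iff_ae_eq_zero).1 h2))

/-- The norm `‖u‖_{L_α} = ‖ |y|^{(α-2)/2} / (1 + |y|^α) · u ‖_{L²(ℝ²)}`. -/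
instance LSpace.instNormedAddCommGroup (α : ℝ) : NormedAddCommGroup (LSpace α) :=
  NormedAddCommGroup.induced _ _ (LSpace.toL2 α) (LSpace.toL2_injective α)

instance LSpace.instNormedSpace (α : ℝ) : NormedSpace ℝ (LSpace α) :=
  NormedSpace.induced ℝ _ _ (LSpace.toL2 α)

/-- The norm
`‖u‖_{H_α} = (‖∇u‖²_{L²(ℝ²)} + ‖ |y|^{(α-2)/2} / (1 + |y|^α) · u ‖²_{L²(ℝ²)})^{1/2}`. -/
instance HSpace.instNormedAddCommGroup (α : ℝ) : NormedAddCommGroup (HSpace α) :=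
  NormedAddCommGroup.induced _ _ (HSpace.toL2 α) (HSpace.toL2_injective α)

instance HSpace.instNormedSpace (α : ℝ) : NormedSpace ℝ (HSpace α) :=
  NormedSpace.induced ℝ _ _ (HSpace.toL2 α)

lemma LSpace.norm_eq (α : ℝ) (u : LSpace α) :
    ‖u‖ = (eLpNorm (weighted α u.1) 2 volume).toReal :=
  Lp.norm_toLp _ u.2

lemma HSpace.norm_eq (α : ℝ) (u : HSpace α) :
    ‖u‖ = Real.sqrt ((eLpNorm (weakGradient u.1) 2 volume).toReal ^ 2
      + (eLpNorm (weighted α u.1) 2 volume).toReal ^ 2) := by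
  have h : ‖u‖ = ‖(WithLp.toLp 2
    (MemLp.toLp (weakGradient u.1) u.2.1, MemLp.toLp (weighted α u.1) u.2.2) :
      WithLp 2 (Lp Plane 2 (volume : Measure Plane) × Lp ℝ 2 (volume : Measure Plane)))‖ := rfl
  have h1 := Lp.norm_toLp _ u.2.1
  have h2 := Lp.norm_toLp _ u.2.2
  rw [h, WithLp.prod_norm_eq_of_L2, ← h1, ← h2]
  rfl

/-- The embedding `i_α : H_α(ℝ²) ↪ L_α(ℝ²)`, `u ↦ u`, as a continuous linear map. -/
def embedding (α : ℝ) : HSpace α →L[ℝ] LSpace α :=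
  LinearMap.mkContinuous
    { toFun := fun u => ⟨u.1, u.2.2⟩
      map_add' := fun _ _ => rfl
      map_smul' := fun _ _ => rfl } 1 (by
    intro u
    rw [one_mul, HSpace.norm_eq, LSpace.norm_eq]
    exact Real.le_sqrt_of_sq_le (le_add_of_nonneg_left (sq_nonneg _)))

end

end WeightedSobolev

/-!
Compactness of the embedding `H_α(ℝ²) ↪ L_α(ℝ²)` for `α ≥ 2`.

Everything rests on one estimate, `lintegral_sub_comp_le`: if `g` is the weak gradient of `u`, then
a weighted `L²` norm of `u(T y) - u(y)`, for an affine map `T y = y + (s y + h)` with `s ≥ 0`, is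
bounded by the Dirichlet integral `∫ |g|²`. It is used in three ways.

* Dilation by `2`, near the origin: the mass of `u²` in a disc is bounded by the `H_α` norm although
  the weight may vanish at the origin (`lintegral_ball_le_annulus`, `lintegral_ball_le`).
* Dilation by `2`, near infinity: the weighted mass outside a disc of radius `2^k` is
  `O(k 2^{-k}) ‖u‖²` (`tailIntegral_two_mul_le`, `lintegral_weight_tail_le`).
* Translations: on a fine grid of squares, `u` is `L²`-close to its averages over the squares
  (`lintegral_iUnion_gridCell_le`).

Together these say that, up to `ε ‖u‖`, the weighted norm of `u` is controlled by finitely many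
averages of `u` (`norm_embedding_sq_le`), so the image of the unit ball is totally bounded
(`totallyBounded_image_closedBall`). As `L_α` is not complete, it remains to see that this image is
closed in `L²(ℝ²)`: `H_α` is a Hilbert space (`HSpace.isClosed_range_toL2`), and a bounded operator
maps the weakly compact unit ball of a Hilbert space to a closed set (`isClosed_image_closedBall`).
-/

namespace WeightedSobolev

open Set Filter Topology Metric ContinuousLinearMap
open scoped ENNReal NNReal Convolution

/-! ### Square integrals and the difference estimate for smooth functions -/

lemma lintegral_enorm_sq {X F : Type*} [MeasurableSpace X] [NormedAddCommGroup F]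
    (μ : Measure X) (f : X → F) : ∫⁻ x, ‖f x‖ₑ ^ 2 ∂μ = eLpNorm f 2 μ ^ 2 := by
  have h := eLpNorm_nnreal_pow_eq_lintegral (μ := μ) (f := f) (p := 2) (by norm_num)
  simpa using h.symm

lemma sq_lintegral_le {X : Type*} [MeasurableSpace X] {μ : Measure X} {f : X → ℝ≥0∞}
    (hf : AEMeasurable f μ) : (∫⁻ x, f x ∂μ) ^ 2 ≤ μ univ * ∫⁻ x, f x ^ 2 ∂μ := by
  have h := ENNReal.lintegral_mul_le_Lp_mul_Lq μ Real.HolderConjugate.two_two hf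
    (aemeasurable_const (b := (1 : ℝ≥0∞)))
  simp only [Pi.mul_apply, mul_one, ENNReal.one_rpow, lintegral_one] at h
  calc (∫⁻ x, f x ∂μ) ^ 2
      ≤ ((∫⁻ x, f x ^ (2 : ℝ) ∂μ) ^ (1 / 2 : ℝ) * μ univ ^ (1 / 2 : ℝ)) ^ 2 := by gcongr
    _ = μ univ * ∫⁻ x, f x ^ 2 ∂μ := by
      rw [mul_pow, ← ENNReal.rpow_natCast, ← ENNReal.rpow_natCast, ← ENNReal.rpow_mul,
        ← ENNReal.rpow_mul, mul_comm]
      norm_num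

/-- The Cauchy–Schwarz inequality for the measure with density `k`. -/
lemma sq_lintegral_mul_le {X : Type*} [MeasurableSpace X] {μ : Measure X} {k f : X → ℝ≥0∞}
    (hk : AEMeasurable k μ) (hf : AEMeasurable f μ) :
    (∫⁻ x, k x * f x ∂μ) ^ 2 ≤ (∫⁻ x, k x ∂μ) * ∫⁻ x, k x * f x ^ 2 ∂μ := by
  have h := sq_lintegral_le (μ := μ.withDensity k)
    (hf.mono_ac (withDensity_absolutelyContinuous μ k))
  rwa [lintegral_withDensity_eq_lintegral_mul₀ hk hf,
    lintegral_withDensity_eq_lintegral_mul₀ hk (hf.pow_const 2),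
    withDensity_apply _ MeasurableSet.univ, setLIntegral_univ] at h

lemma lintegral_comp_smul_add {r : ℝ} (hr : r ≠ 0) (h : Plane) (f : Plane → ℝ≥0∞) :
    ∫⁻ y, f (r • y + h) = ENNReal.ofReal ((r ^ 2)⁻¹) * ∫⁻ y, f y := by
  have h1 : ∫⁻ y, f (r • y + h) = ∫⁻ y, f (y + h) ∂(Measure.map (r • ·) volume) :=
    (lintegral_map_equiv (fun y => f (y + h))
      (Homeomorph.smulOfNeZero r hr).toMeasurableEquiv).symm
  rw [h1, Measure.map_addHaar_smul _ hr, lintegral_smul_measure, smul_eq_mul,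
    lintegral_add_right_eq_self]
  simp

lemma lintegral_comp_smul_add_le {r : ℝ} (hr : 1 ≤ r) (h : Plane) (f : Plane → ℝ≥0∞) :
    ∫⁻ y, f (r • y + h) ≤ ∫⁻ y, f y := by
  rw [lintegral_comp_smul_add (by positivity)]
  refine mul_le_of_le_one_left' (ENNReal.ofReal_le_one.2 (inv_le_one_of_one_le₀ ?_))
  nlinarith

lemma enorm_sub_sq_le {v : Plane → ℝ} (hv : ContDiff ℝ 1 v) (y z : Plane) :
    ‖v (y + z) - v y‖ₑ ^ 2 ≤ ‖z‖ₑ ^ 2 * ∫⁻ t in Ioc (0 : ℝ) 1, ‖fderiv ℝ v (y + t • z)‖ₑ ^ 2 := by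
  have hc : Continuous fun t : ℝ => fderiv ℝ v (y + t • z) :=
    (hv.continuous_fderiv (by simp)).comp (by fun_prop)
  have hd : ∀ t : ℝ, HasDerivAt (fun t : ℝ => v (y + t • z)) (fderiv ℝ v (y + t • z) z) t := by
    intro t
    have h1 : HasDerivAt (fun t : ℝ => y + t • z) z t := by
      simpa using ((hasDerivAt_id t).smul_const z).const_add y
    exact ((hv.differentiable (by simp)) (y + t • z)).hasFDerivAt.comp_hasDerivAt t h1
  have h2 : v (y + z) - v y = ∫ t in (0 : ℝ)..1, fderiv ℝ v (y + t • z) z := by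
    rw [intervalIntegral.integral_eq_sub_of_hasDerivAt (fun t _ => hd t)
      ((hc.clm_apply continuous_const).intervalIntegrable _ _)]
    simp
  rw [h2, intervalIntegral.integral_of_le zero_le_one]
  calc _ ≤ (∫⁻ t in Ioc (0 : ℝ) 1, ‖fderiv ℝ v (y + t • z)‖ₑ * ‖z‖ₑ) ^ 2 := by
        gcongr
        refine (enorm_integral_le_lintegral_enorm _).trans (lintegral_mono fun t => ?_)
        exact ContinuousLinearMap.le_opENorm _ _
    _ = ‖z‖ₑ ^ 2 * (∫⁻ t in Ioc (0 : ℝ) 1, ‖fderiv ℝ v (y + t • z)‖ₑ) ^ 2 := by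
        rw [lintegral_mul_const' _ _ enorm_ne_top, mul_pow, mul_comm]
    _ ≤ _ := by
        gcongr
        simpa using sq_lintegral_le (μ := volume.restrict (Ioc (0 : ℝ) 1))
          hc.enorm.measurable.aemeasurable

/-- The `L²` size of `v ∘ T - v` for the affine map `T y = y + (s y + h)`, with a weight that
compensates the displacement `s y + h`. Along the segments from `y` to `T y` the maps
`y ↦ y + t (s y + h)` have Jacobian `(1 + t s)² ≥ 1`, so they do not increase the Dirichlet integral. -/
lemma lintegral_sub_comp_le_of_contDiff {v : Plane → ℝ} (hv : ContDiff ℝ 1 v) {s : ℝ} (hs : 0 ≤ s)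
    (h : Plane) {ρ : Plane → ℝ≥0∞} {M : ℝ≥0∞} (hM : M ≠ ⊤)
    (hρ : ∀ y, ρ y * ‖s • y + h‖ₑ ^ 2 ≤ M) :
    ∫⁻ y, ρ y * ‖v (y + (s • y + h)) - v y‖ₑ ^ 2 ≤ M * ∫⁻ y, ‖fderiv ℝ v y‖ₑ ^ 2 := by
  have hc := hv.continuous_fderiv (by simp)
  calc ∫⁻ y, ρ y * ‖v (y + (s • y + h)) - v y‖ₑ ^ 2
      ≤ ∫⁻ y, M * ∫⁻ t in Ioc (0 : ℝ) 1, ‖fderiv ℝ v (y + t • (s • y + h))‖ₑ ^ 2 := by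
        refine lintegral_mono fun y => ?_
        calc _ ≤ ρ y * (‖s • y + h‖ₑ ^ 2 *
                ∫⁻ t in Ioc (0 : ℝ) 1, ‖fderiv ℝ v (y + t • (s • y + h))‖ₑ ^ 2) := by
              gcongr
              exact enorm_sub_sq_le hv _ _
          _ ≤ _ := by
              rw [← mul_assoc]
              exact mul_le_mul_left (hρ y) _
    _ = M * ∫⁻ t in Ioc (0 : ℝ) 1, ∫⁻ y, ‖fderiv ℝ v (y + t • (s • y + h))‖ₑ ^ 2 := by
        rw [lintegral_const_mul' _ _ hM]
        congr 1
        refine lintegral_lintegral_swap (Continuous.aemeasurable ?_)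
        have : Continuous fun p : Plane × ℝ => fderiv ℝ v (p.1 + p.2 • (s • p.1 + h)) :=
          hc.comp (by fun_prop)
        exact (ENNReal.continuous_pow 2).comp this.enorm
    _ ≤ M * ∫⁻ t in Ioc (0 : ℝ) 1, ∫⁻ y, ‖fderiv ℝ v y‖ₑ ^ 2 := by
        refine mul_le_mul_right (setLIntegral_mono' measurableSet_Ioc fun t ht => ?_) _
        have hr : 1 ≤ 1 + t * s := by nlinarith [mul_nonneg ht.1.le hs]
        have e : ∀ y : Plane, y + t • (s • y + h) = (1 + t * s) • y + t • h := fun y => by module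
        simp only [e]
        exact lintegral_comp_smul_add_le hr (t • h) fun y => ‖fderiv ℝ v y‖ₑ ^ 2
    _ = _ := by simp

/-! ### Mollification and the difference estimate for weakly differentiable functions -/

/-- The weak gradient tested in an arbitrary direction instead of a coordinate direction. -/
lemma IsWeakGradient.integral_mul_fderiv {u φ : Plane → ℝ} {g : Plane → Plane}
    (h : IsWeakGradient u g) (hu : MemL2Loc u) (hg : MemL2Loc g) (hφ : ContDiff ℝ ∞ φ)
    (hc : HasCompactSupport φ) (z : Plane) :
    ∫ y, u y * fderiv ℝ φ y z = - ∫ y, inner ℝ (g y) z * φ y := by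
  have hz : z = z 0 • EuclideanSpace.single 0 1 + z 1 • EuclideanSpace.single 1 1 := by
    ext i; fin_cases i <;> simp
  have e1 : ∀ y, u y * fderiv ℝ φ y z = z 0 * (u y * fderiv ℝ φ y (EuclideanSpace.single 0 1)) +
      z 1 * (u y * fderiv ℝ φ y (EuclideanSpace.single 1 1)) := by
    intro y
    conv_lhs => rw [hz, map_add, map_smul, map_smul]
    simp only [smul_eq_mul]; ring
  have e2 : ∀ y, inner ℝ (g y) z * φ y = z 0 * (g y 0 * φ y) + z 1 * (g y 1 * φ y) := by
    intro y
    simp [PiLp.inner_apply, Fin.sum_univ_two]; ring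
  simp only [e1, e2]
  rw [integral_add ((integrable_mul_fderiv hu hφ hc _).const_mul _)
      ((integrable_mul_fderiv hu hφ hc _).const_mul _),
    integral_add ((integrable_coord_mul hg hφ hc _).const_mul _)
      ((integrable_coord_mul hg hφ hc _).const_mul _)]
  simp only [integral_const_mul]
  rw [h φ hφ hc 0, h φ hφ hc 1]; ring

lemma IsWeakGradient.fderiv_convolution {u k : Plane → ℝ} {g : Plane → Plane}
    (h : IsWeakGradient u g) (hu : MemL2Loc u) (hg : MemL2Loc g) (hk : ContDiff ℝ ∞ k)
    (hc : HasCompactSupport k) (x z : Plane) :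
    fderiv ℝ (k ⋆[lsmul ℝ ℝ, volume] u) x z = ∫ t, k (x - t) * inner ℝ (g t) z := by
  have hd := hc.hasFDerivAt_convolution_left (lsmul ℝ ℝ) (μ := volume)
    (hk.of_le (by exact_mod_cast le_top)) hu.locallyIntegrable x
  have hφ : ContDiff ℝ ∞ fun t => k (x - t) := hk.comp (contDiff_const.sub contDiff_id)
  have hφc : HasCompactSupport fun t => k (x - t) :=
    hc.comp_homeomorph (Homeomorph.subLeft x)
  have hφd : ∀ t, fderiv ℝ (fun t => k (x - t)) t = - fderiv ℝ k (x - t) := fun t => by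
    have h1 : HasFDerivAt (fun t => x - t) (-ContinuousLinearMap.id ℝ Plane) t :=
      (hasFDerivAt_id t).const_sub x
    have h2 := ((hk.differentiable (by simp)) (x - t)).hasFDerivAt.comp t h1
    rw [show (fun t => k (x - t)) = k ∘ fun t => x - t from rfl, h2.fderiv]
    ext; simp
  rw [hd.fderiv, convolution_eq_swap, ContinuousLinearMap.integral_apply]
  · have := h.integral_mul_fderiv hu hg hφ hφc z
    simp only [hφd, _root_.neg_apply, mul_neg, integral_neg, neg_inj] at this
    rw [← integral_congr_ae (.of_forall fun t => mul_comm (inner ℝ (g t) z) (k (x - t))), ← this]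
    refine integral_congr_ae (.of_forall fun t => ?_)
    simp [ContinuousLinearMap.precompL_apply, mul_comm]
  · have := (hc.fderiv ℝ).convolutionExists_left ((lsmul ℝ ℝ).precompL Plane) (μ := volume)
      (hk.continuous_fderiv (by simp)) hu.locallyIntegrable x
    exact this.integrable_swap

lemma IsWeakGradient.enorm_fderiv_convolution_le {u k : Plane → ℝ} {g : Plane → Plane}
    (h : IsWeakGradient u g) (hu : MemL2Loc u) (hg : MemL2Loc g) (hk : ContDiff ℝ ∞ k)
    (hc : HasCompactSupport k) (x : Plane) :
    ‖fderiv ℝ (k ⋆[lsmul ℝ ℝ, volume] u) x‖ₑ ≤ ∫⁻ t, ‖k (x - t)‖ₑ * ‖g t‖ₑ := by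
  refine ContinuousLinearMap.opENorm_le_bound _ fun z => ?_
  rw [h.fderiv_convolution hu hg hk hc, ← lintegral_mul_const' _ _ enorm_ne_top]
  refine (enorm_integral_le_lintegral_enorm _).trans (lintegral_mono fun t => ?_)
  rw [enorm_mul, mul_assoc]
  gcongr
  rw [← enorm_norm (g t), ← enorm_norm z, ← enorm_mul]
  refine enorm_le_iff_norm_le.2 ((abs_real_inner_le_norm _ _).trans (le_abs_self _))

/-- Mollification does not increase the Dirichlet integral, by Jensen's inequality and Tonelli's
theorem. -/
lemma IsWeakGradient.lintegral_fderiv_convolution_le {u k : Plane → ℝ} {g : Plane → Plane}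
    (h : IsWeakGradient u g) (hu : MemL2Loc u) (hg : MemL2Loc g) (hk : ContDiff ℝ ∞ k)
    (hc : HasCompactSupport k) (hk1 : ∫⁻ x, ‖k x‖ₑ = 1) :
    ∫⁻ x, ‖fderiv ℝ (k ⋆[lsmul ℝ ℝ, volume] u) x‖ₑ ^ 2 ≤ ∫⁻ x, ‖g x‖ₑ ^ 2 := by
  have hkc := hk.continuous
  have hgm : AEMeasurable (fun t => ‖g t‖ₑ) volume := hg.locallyIntegrable.aestronglyMeasurable.enorm
  calc ∫⁻ x, ‖fderiv ℝ (k ⋆[lsmul ℝ ℝ, volume] u) x‖ₑ ^ 2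
      ≤ ∫⁻ x, ∫⁻ t, ‖k (x - t)‖ₑ * ‖g t‖ₑ ^ 2 := by
        refine lintegral_mono fun x => ?_
        calc _ ≤ (∫⁻ t, ‖k (x - t)‖ₑ * ‖g t‖ₑ) ^ 2 := by
              gcongr
              exact h.enorm_fderiv_convolution_le hu hg hk hc x
          _ ≤ (∫⁻ t, ‖k (x - t)‖ₑ) * ∫⁻ t, ‖k (x - t)‖ₑ * ‖g t‖ₑ ^ 2 :=
              sq_lintegral_mul_le
                (hkc.comp (continuous_const.sub continuous_id)).enorm.measurable.aemeasurable hgm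
          _ = _ := by
              rw [lintegral_sub_left_eq_self (fun t => ‖k t‖ₑ), hk1, one_mul]
    _ = ∫⁻ t, ∫⁻ x, ‖k (x - t)‖ₑ * ‖g t‖ₑ ^ 2 := by
        refine lintegral_lintegral_swap ?_
        refine AEMeasurable.mul (f := fun p : Plane × Plane => ‖k (p.1 - p.2)‖ₑ)
          (Continuous.aemeasurable ?_) ?_
        · have : Continuous fun p : Plane × Plane => k (p.1 - p.2) := by fun_prop
          exact this.enorm
        · exact (hgm.pow_const 2).comp_snd
    _ = _ := by
        refine lintegral_congr fun t => ?_
        rw [lintegral_mul_const' _ _ (by simp), lintegral_sub_right_eq_self (fun t => ‖k t‖ₑ), hk1,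
          one_mul]

/-- Smooth approximation that converges almost everywhere and does not increase the Dirichlet
integral. -/
lemma exists_contDiff_tendsto {u : Plane → ℝ} {g : Plane → Plane}
    (h : IsWeakGradient u g) (hu : MemL2Loc u) (hg : MemL2Loc g) :
    ∃ v : ℕ → Plane → ℝ, (∀ n, ContDiff ℝ 1 (v n)) ∧
      (∀ᵐ x, Tendsto (fun n => v n x) atTop (𝓝 (u x))) ∧
      ∀ n, ∫⁻ x, ‖fderiv ℝ (v n) x‖ₑ ^ 2 ≤ ∫⁻ x, ‖g x‖ₑ ^ 2 := by
  let φ : ℕ → ContDiffBump (0 : Plane) := fun n =>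
    ⟨1 / ((n : ℝ) + 1), 2 * (1 / ((n : ℝ) + 1)), by positivity, by
      have : 0 < 1 / ((n : ℝ) + 1) := by positivity
      linarith⟩
  have hloc := hu.locallyIntegrable
  refine ⟨fun n => (φ n).normed volume ⋆[lsmul ℝ ℝ, volume] u, fun n => ?_, ?_, fun n => ?_⟩
  · have hs : HasCompactSupport ((φ n).normed volume) := (φ n).hasCompactSupport_normed
    have hn : ContDiff ℝ 1 ((φ n).normed volume) := (φ n).contDiff_normed
    exact hs.contDiff_convolution_left (n := 1) (lsmul ℝ ℝ) hn hloc
  · refine ContDiffBump.ae_convolution_tendsto_right_of_locallyIntegrable (K := 2) ?_ ?_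
      hu.locallyIntegrable
    · simpa [φ] using (tendsto_one_div_add_atTop_nhds_zero_nat (𝕜 := ℝ)).const_mul 2
    · exact .of_forall fun n => le_rfl
  · refine h.lintegral_fderiv_convolution_le hu hg (φ n).contDiff_normed
      (φ n).hasCompactSupport_normed ?_
    have h1 := ofReal_integral_eq_lintegral_ofReal ((φ n).integrable_normed (μ := volume))
      (.of_forall (φ n).nonneg_normed)
    rw [(φ n).integral_normed, ENNReal.ofReal_one] at h1
    rw [h1]
    exact lintegral_congr fun x => Real.enorm_of_nonneg ((φ n).nonneg_normed x)

lemma quasiMeasurePreserving_smul_add {r : ℝ} (hr : r ≠ 0) (h : Plane) :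
    Measure.QuasiMeasurePreserving (fun y : Plane => r • y + h) volume volume := by
  refine ⟨by fun_prop, fun s hs => ?_⟩
  obtain ⟨t, hst, ht, ht0⟩ := exists_measurable_superset_of_null hs
  refine measure_mono_null hst ?_
  rw [Measure.map_apply (by fun_prop) ht, ← lintegral_indicator_one
    (measurableSet_preimage (by fun_prop) ht)]
  have := lintegral_comp_smul_add hr h (t.indicator 1)
  rw [lintegral_indicator_one ht, ht0, mul_zero] at this
  exact this

/-- The basic estimate. It bounds differences under translations (`s = 0`) and under the dilation
by `2` (`s = 1`, `h = 0`) by the Dirichlet integral alone. It follows from the smooth case by Fatou's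
lemma. -/
theorem lintegral_sub_comp_le {u : Plane → ℝ} {g : Plane → Plane}
    (hw : IsWeakGradient u g) (hu : MemL2Loc u) (hg : MemL2Loc g) {s : ℝ} (hs : 0 ≤ s)
    (h : Plane) {ρ : Plane → ℝ≥0∞} (hρm : Measurable ρ) (hρt : ∀ y, ρ y ≠ ⊤)
    {M : ℝ≥0∞} (hM : M ≠ ⊤) (hρ : ∀ y, ρ y * ‖s • y + h‖ₑ ^ 2 ≤ M) :
    ∫⁻ y, ρ y * ‖u (y + (s • y + h)) - u y‖ₑ ^ 2 ≤ M * ∫⁻ y, ‖g y‖ₑ ^ 2 := by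
  obtain ⟨v, hv, hvu, hvg⟩ := exists_contDiff_tendsto hw hu hg
  have e : ∀ y : Plane, (1 + s) • y + h = y + (s • y + h) := fun y => by module
  have hvu' : ∀ᵐ y, Tendsto (fun n => v n (y + (s • y + h))) atTop (𝓝 (u (y + (s • y + h)))) := by
    have := (quasiMeasurePreserving_smul_add (r := 1 + s) (by positivity) h).ae hvu
    simpa only [e] using this
  have hlim : ∀ᵐ y, ρ y * ‖u (y + (s • y + h)) - u y‖ₑ ^ 2 ≤
      liminf (fun n => ρ y * ‖v n (y + (s • y + h)) - v n y‖ₑ ^ 2) atTop := by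
    filter_upwards [hvu, hvu'] with y h1 h2
    refine (ENNReal.Tendsto.const_mul ?_ (.inr (hρt y))).liminf_eq.ge
    exact ((ENNReal.continuous_pow 2).tendsto _).comp (h2.sub h1).enorm
  calc _ ≤ ∫⁻ y, liminf (fun n => ρ y * ‖v n (y + (s • y + h)) - v n y‖ₑ ^ 2) atTop :=
        lintegral_mono_ae hlim
    _ ≤ liminf (fun n => ∫⁻ y, ρ y * ‖v n (y + (s • y + h)) - v n y‖ₑ ^ 2) atTop := by
        refine lintegral_liminf_le fun n => ?_
        have := (hv n).continuous
        exact hρm.mul (by fun_prop)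
    _ ≤ _ := by
        refine liminf_le_of_le (by isBoundedDefault) fun b hb => ?_
        obtain ⟨n, hn⟩ := hb.exists
        exact hn.trans ((lintegral_sub_comp_le_of_contDiff (hv n) hs h hM hρ).trans
          (mul_le_mul_right (hvg n) _))

/-! ### Dilation estimates near the origin and near infinity -/

lemma enorm_sq_eq_ofReal (a : ℝ) : ‖a‖ₑ ^ 2 = ENNReal.ofReal (a ^ 2) := by
  rw [← enorm_pow, Real.enorm_of_nonneg (sq_nonneg a)]

lemma enorm_sq_le_two_mul (a b : ℝ) : ‖a‖ₑ ^ 2 ≤ 2 * ‖b‖ₑ ^ 2 + 2 * ‖b - a‖ₑ ^ 2 := by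
  simp only [enorm_sq_eq_ofReal]
  rw [← ENNReal.ofReal_ofNat 2, ← ENNReal.ofReal_mul (by norm_num),
    ← ENNReal.ofReal_mul (by norm_num), ← ENNReal.ofReal_add (by positivity) (by positivity)]
  exact ENNReal.ofReal_le_ofReal (by nlinarith [sq_nonneg (2 * b - a)])

lemma lintegral_mul_dilation_le {u : Plane → ℝ} {g : Plane → Plane}
    (hw : IsWeakGradient u g) (hu : MemL2Loc u) (hg : MemL2Loc g)
    {ρ : Plane → ℝ≥0∞} (hρm : Measurable ρ) (hρt : ∀ y, ρ y ≠ ⊤) {M : ℝ≥0∞} (hM : M ≠ ⊤)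
    (hρ : ∀ y, ρ y * ‖y‖ₑ ^ 2 ≤ M) :
    ∫⁻ y, ρ y * ‖u ((2 : ℝ) • y) - u y‖ₑ ^ 2 ≤ M * ∫⁻ y, ‖g y‖ₑ ^ 2 := by
  have := lintegral_sub_comp_le hw hu hg zero_le_one 0 hρm hρt hM (by simpa using hρ)
  simpa [two_smul] using this

lemma lintegral_comp_two_smul (f : Plane → ℝ≥0∞) :
    4 * ∫⁻ y, f ((2 : ℝ) • y) = ∫⁻ y, f y := by
  have := lintegral_comp_smul_add (r := 2) (by norm_num) 0 f
  simp only [add_zero] at this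
  rw [this, ← mul_assoc, ← ENNReal.ofReal_ofNat 4, ← ENNReal.ofReal_mul (by norm_num)]
  norm_num

lemma aemeasurable_enorm_sq {u : Plane → ℝ} (hu : MemL2Loc u) :
    AEMeasurable (fun y => ‖u y‖ₑ ^ 2) volume :=
  hu.locallyIntegrable.aestronglyMeasurable.enorm.pow_const 2

lemma lintegral_ball_lt_top {u : Plane → ℝ} (hu : MemL2Loc u) (R : ℝ) :
    ∫⁻ y in ball 0 R, ‖u y‖ₑ ^ 2 < ⊤ := by
  refine (lintegral_mono_set (ball_subset_closedBall (x := (0 : Plane)))).trans_lt ?_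
  rw [lintegral_enorm_sq]
  exact ENNReal.pow_lt_top (hu _ (isCompact_closedBall 0 R)).2

/-- The mass of `u²` in a disc is controlled by its mass in a surrounding annulus and the Dirichlet
integral: `u(y)` is compared with `u(2y)`, which gives `S(R) ≤ S(2R) / 2 + 2R² ‖∇u‖²` for
`S(R) = ∫_{|y| < R} u²`, and the part of `S(2R)` over the disc of radius `R` is absorbed, as
`S(R)` is finite. This step is needed because the weight vanishes at the origin for `α > 2`. -/
theorem lintegral_ball_le_annulus {u : Plane → ℝ} {g : Plane → Plane}
    (hw : IsWeakGradient u g) (hu : MemL2Loc u) (hg : MemL2Loc g) {R : ℝ} (hR : 0 < R) :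
    ∫⁻ y in ball 0 R, ‖u y‖ₑ ^ 2 ≤ (∫⁻ y in ball 0 (2 * R) \ ball 0 R, ‖u y‖ₑ ^ 2) +
      ENNReal.ofReal (4 * R ^ 2) * ∫⁻ y, ‖g y‖ₑ ^ 2 := by
  have hdil : ∫⁻ y in ball 0 R, ‖u ((2 : ℝ) • y) - u y‖ₑ ^ 2 ≤
      ENNReal.ofReal (R ^ 2) * ∫⁻ y, ‖g y‖ₑ ^ 2 := by
    rw [← lintegral_indicator measurableSet_ball]
    have := lintegral_mul_dilation_le hw hu hg (ρ := (ball (0 : Plane) R).indicator 1)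
      (measurable_one.indicator measurableSet_ball)
      (fun y => by by_cases hy : y ∈ ball (0 : Plane) R <;> simp [hy])
      (M := ENNReal.ofReal (R ^ 2)) ENNReal.ofReal_ne_top (fun y => by
        by_cases hy : y ∈ ball (0 : Plane) R
        · rw [indicator_of_mem hy, Pi.one_apply, one_mul, ← enorm_norm y, enorm_sq_eq_ofReal]
          refine ENNReal.ofReal_le_ofReal ?_
          have := mem_ball_zero_iff.1 hy
          gcongr
        · simp [hy])
    refine le_of_eq_of_le (lintegral_congr fun y => ?_) this
    by_cases hy : y ∈ ball (0 : Plane) R <;> simp only [indicator, hy, if_true, if_false] <;> simp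
  have hscale : 4 * ∫⁻ y in ball 0 R, ‖u ((2 : ℝ) • y)‖ₑ ^ 2 =
      ∫⁻ y in ball 0 (2 * R), ‖u y‖ₑ ^ 2 := by
    rw [← lintegral_indicator measurableSet_ball, ← lintegral_indicator measurableSet_ball,
      ← lintegral_comp_two_smul (indicator (ball 0 (2 * R)) _)]
    congr 1
    refine lintegral_congr fun y => ?_
    simp only [indicator, mem_ball_zero_iff, norm_smul, Real.norm_ofNat,
      mul_lt_mul_iff_right₀ (zero_lt_two' ℝ)]
  have hsplit : ∫⁻ y in ball 0 (2 * R), ‖u y‖ₑ ^ 2 = (∫⁻ y in ball 0 R, ‖u y‖ₑ ^ 2) +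
      ∫⁻ y in ball 0 (2 * R) \ ball 0 R, ‖u y‖ₑ ^ 2 := by
    rw [← lintegral_inter_add_sdiff _ (ball (0 : Plane) (2 * R))
        (measurableSet_ball (x := 0) (ε := R)),
      inter_eq_self_of_subset_right (ball_subset_ball (by linarith))]
  have hmu2 : AEMeasurable (fun y => ‖u ((2 : ℝ) • y)‖ₑ ^ 2) volume := by
    have := (aemeasurable_enorm_sq hu).comp_quasiMeasurePreserving
      (quasiMeasurePreserving_smul_add (r := 2) (by norm_num) 0)
    simpa [Function.comp_def] using this
  have hmain : ∫⁻ y in ball 0 R, ‖u y‖ₑ ^ 2 ≤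
      2 * (∫⁻ y in ball 0 R, ‖u ((2 : ℝ) • y)‖ₑ ^ 2) +
      2 * ∫⁻ y in ball 0 R, ‖u ((2 : ℝ) • y) - u y‖ₑ ^ 2 := by
    rw [← lintegral_const_mul' _ _ (by simp), ← lintegral_const_mul' _ _ (by simp),
      ← lintegral_add_left' (hmu2.const_mul _).restrict]
    exact lintegral_mono fun y => enorm_sq_le_two_mul _ _
  -- absorb the integral over the ball, which is finite
  refine (ENNReal.add_le_add_iff_left (lintegral_ball_lt_top hu R).ne).1 ?_
  rw [← add_assoc, ← hsplit, ← hscale, ← two_mul]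
  calc _ ≤ 2 * (2 * (∫⁻ y in ball 0 R, ‖u ((2 : ℝ) • y)‖ₑ ^ 2) +
      2 * (ENNReal.ofReal (R ^ 2) * ∫⁻ y, ‖g y‖ₑ ^ 2)) := by gcongr; exact hmain.trans (by gcongr)
    _ = _ := by
      rw [ENNReal.ofReal_mul (by norm_num), ENNReal.ofReal_ofNat]
      ring

/-- The part over `{R ≤ |y|}` of the integral of `|y|^{-α-2} u²`. -/
noncomputable def tailIntegral (α : ℝ) (u : Plane → ℝ) (R : ℝ) : ℝ≥0∞ :=
  ∫⁻ y in {y | R ≤ ‖y‖}, ENNReal.ofReal (‖y‖ ^ (-α - 2)) * ‖u y‖ₑ ^ 2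

lemma measurableSet_le_norm (R : ℝ) : MeasurableSet {y : Plane | R ≤ ‖y‖} :=
  measurableSet_le measurable_const measurable_norm

/-- Each doubling of the radius halves the tail, up to a multiple of the Dirichlet integral: `u(2y)` is
compared with `u(y)`, and the scaling factor is `4 · 2 · 2^{-α-2} ≤ 1 / 2` because `α ≥ 2`. -/
theorem tailIntegral_two_mul_le {α : ℝ} (hα : 2 ≤ α) {u : Plane → ℝ} {g : Plane → Plane}
    (hw : IsWeakGradient u g) (hu : MemL2Loc u) (hg : MemL2Loc g) {R : ℝ} (hR : 1 ≤ R) :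
    tailIntegral α u (2 * R) ≤
      2⁻¹ * (tailIntegral α u R + ENNReal.ofReal R⁻¹ * ∫⁻ y, ‖g y‖ₑ ^ 2) := by
  have hR0 : 0 < R := by linarith
  set p : Plane → ℝ≥0∞ := fun y => ENNReal.ofReal (‖y‖ ^ (-α - 2)) with hp
  have hpm : Measurable p := (measurable_norm.pow_const _).ennreal_ofReal
  set s : Set Plane := {y | R ≤ ‖y‖} with hs
  have hsm : MeasurableSet s := measurableSet_le_norm R
  have hdil : ∫⁻ y in s, p y * ‖u ((2 : ℝ) • y) - u y‖ₑ ^ 2 ≤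
      ENNReal.ofReal R⁻¹ * ∫⁻ y, ‖g y‖ₑ ^ 2 := by
    rw [← lintegral_indicator hsm]
    have := lintegral_mul_dilation_le hw hu hg (ρ := s.indicator p)
      (hpm.indicator hsm)
      (fun y => by by_cases hy : y ∈ s <;> simp [hy, p])
      (M := ENNReal.ofReal R⁻¹) ENNReal.ofReal_ne_top (fun y => by
        by_cases hy : y ∈ s
        · have hy' : R ≤ ‖y‖ := hy
          have hy0 : 0 < ‖y‖ := hR0.trans_le hy'
          rw [indicator_of_mem hy, ← enorm_norm y, enorm_sq_eq_ofReal,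
            ← ENNReal.ofReal_mul (by positivity)]
          refine ENNReal.ofReal_le_ofReal ?_
          rw [← Real.rpow_natCast, ← Real.rpow_add hy0]
          calc ‖y‖ ^ (-α - 2 + ((2 : ℕ) : ℝ)) ≤ ‖y‖ ^ (-1 : ℝ) :=
                Real.rpow_le_rpow_of_exponent_le (hR.trans hy') (by push_cast; linarith)
            _ = ‖y‖⁻¹ := Real.rpow_neg_one _
            _ ≤ R⁻¹ := by gcongr
        · simp [hy])
    refine le_of_eq_of_le (lintegral_congr fun y => ?_) this
    by_cases hy : y ∈ s <;> simp only [indicator, hy, if_true, if_false]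
    simp
  have hmu2 : AEMeasurable (fun y => p y * ‖u ((2 : ℝ) • y)‖ₑ ^ 2) volume := by
    have := (aemeasurable_enorm_sq hu).comp_quasiMeasurePreserving
      (quasiMeasurePreserving_smul_add (r := 2) (by norm_num) 0)
    refine hpm.aemeasurable.mul ?_
    simpa [Function.comp_def] using this
  have hmu : AEMeasurable (fun y => 2 * (p y * ‖u y‖ₑ ^ 2)) volume :=
    (hpm.aemeasurable.mul (aemeasurable_enorm_sq hu)).const_mul _
  have hmain : ∫⁻ y in s, p y * ‖u ((2 : ℝ) • y)‖ₑ ^ 2 ≤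
      2 * (∫⁻ y in s, p y * ‖u y‖ₑ ^ 2) +
      2 * ∫⁻ y in s, p y * ‖u ((2 : ℝ) • y) - u y‖ₑ ^ 2 := by
    rw [← lintegral_const_mul' _ _ (by simp), ← lintegral_const_mul' _ _ (by simp),
      ← lintegral_add_left' hmu.restrict]
    refine lintegral_mono fun y => ?_
    calc p y * ‖u ((2 : ℝ) • y)‖ₑ ^ 2 ≤
        p y * (2 * ‖u y‖ₑ ^ 2 + 2 * ‖u ((2 : ℝ) • y) - u y‖ₑ ^ 2) := by
          gcongr
          rw [← enorm_neg (u ((2 : ℝ) • y) - u y), neg_sub]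
          exact enorm_sq_le_two_mul _ _
      _ = _ := by ring
  -- dilation by `2` turns the weight `|y|^{-α-2}` into `2^{-α-2} |y|^{-α-2} ≤ |y|^{-α-2} / 16`
  have hscale : tailIntegral α u (2 * R) ≤ 4 * (16⁻¹ * ∫⁻ y in s, p y * ‖u ((2 : ℝ) • y)‖ₑ ^ 2) := by
    rw [tailIntegral, ← lintegral_indicator (measurableSet_le_norm _),
      ← lintegral_comp_two_smul (indicator {y | 2 * R ≤ ‖y‖} _),
      ← lintegral_const_mul' (16⁻¹) _ (by simp), ← lintegral_indicator hsm]
    refine mul_le_mul_right (lintegral_mono fun y => ?_) _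
    by_cases hy : R ≤ ‖y‖
    · have hy0 : 0 < ‖y‖ := hR0.trans_le hy
      have h1 : (2 : ℝ) • y ∈ {y : Plane | 2 * R ≤ ‖y‖} := by
        simp only [mem_ofPred_eq, norm_smul, Real.norm_ofNat]; linarith
      rw [indicator_of_mem h1, indicator_of_mem (show y ∈ s from hy), ← mul_assoc]
      gcongr
      have h16 : (16⁻¹ : ℝ≥0∞) = ENNReal.ofReal 16⁻¹ := by
        rw [ENNReal.ofReal_inv_of_pos (by norm_num), ENNReal.ofReal_ofNat]
      rw [h16, hp, ← ENNReal.ofReal_mul (by norm_num)]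
      refine ENNReal.ofReal_le_ofReal ?_
      rw [norm_smul, Real.norm_ofNat, Real.mul_rpow (by norm_num) hy0.le]
      gcongr
      calc (2 : ℝ) ^ (-α - 2) ≤ (2 : ℝ) ^ (-4 : ℝ) :=
            Real.rpow_le_rpow_of_exponent_le (by norm_num) (by linarith)
        _ = 16⁻¹ := by
            rw [Real.rpow_neg (by norm_num)]; norm_num
    · have h1 : (2 : ℝ) • y ∉ {y : Plane | 2 * R ≤ ‖y‖} := by
        simp only [mem_ofPred_eq, norm_smul, Real.norm_ofNat]; linarith
      rw [indicator_of_notMem h1]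
      exact zero_le
  calc _ ≤ 4 * (16⁻¹ * (2 * (∫⁻ y in s, p y * ‖u y‖ₑ ^ 2) +
      2 * (ENNReal.ofReal R⁻¹ * ∫⁻ y, ‖g y‖ₑ ^ 2))) :=
        hscale.trans (by gcongr; exact hmain.trans (by gcongr))
    _ = (4 * 16⁻¹ * 2) * (tailIntegral α u R + ENNReal.ofReal R⁻¹ * ∫⁻ y, ‖g y‖ₑ ^ 2) := by
        rw [tailIntegral]; ring
    _ = _ := by
        congr 1
        rw [← ENNReal.toReal_eq_toReal_iff' (by finiteness) (by finiteness)]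
        norm_num

lemma tailIntegral_two_pow_le {α : ℝ} (hα : 2 ≤ α) {u : Plane → ℝ} {g : Plane → Plane}
    (hw : IsWeakGradient u g) (hu : MemL2Loc u) (hg : MemL2Loc g) (k : ℕ) :
    tailIntegral α u (2 ^ k) ≤ 2⁻¹ ^ k * (tailIntegral α u 1 + k * ∫⁻ y, ‖g y‖ₑ ^ 2) := by
  induction k with
  | zero => simp
  | succ k ih =>
    have hk : ENNReal.ofReal ((2 : ℝ) ^ k)⁻¹ = 2⁻¹ ^ k := by
      rw [ENNReal.ofReal_inv_of_pos (by positivity), ENNReal.ofReal_pow (by norm_num),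
        ENNReal.ofReal_ofNat, ENNReal.inv_pow]
    rw [pow_succ' (2 : ℝ)]
    refine (tailIntegral_two_mul_le hα hw hu hg (one_le_pow₀ (by norm_num))).trans ?_
    rw [hk]
    calc _ ≤ 2⁻¹ * (2⁻¹ ^ k * (tailIntegral α u 1 + k * ∫⁻ y, ‖g y‖ₑ ^ 2) +
          2⁻¹ ^ k * ∫⁻ y, ‖g y‖ₑ ^ 2) := by gcongr
      _ = _ := by push_cast; ring

/-! ### The weight -/

lemma weight_nonneg (α : ℝ) (y : Plane) : 0 ≤ weight α y := by
  unfold weight; positivity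

lemma measurable_weight (α : ℝ) : Measurable (weight α) := by
  unfold weight; fun_prop

lemma weight_le_one {α : ℝ} (hα : 2 ≤ α) (y : Plane) : weight α y ≤ 1 := by
  unfold weight
  have h0 : 0 ≤ ‖y‖ ^ α := by positivity
  rw [div_le_one (by positivity)]
  rcases le_total ‖y‖ 1 with h | h
  · have := Real.rpow_le_one (norm_nonneg y) h (show 0 ≤ (α - 2) / 2 by linarith)
    linarith
  · have := Real.rpow_le_rpow_of_exponent_le h (show (α - 2) / 2 ≤ α by linarith)
    linarith

/-- On `{|y| ≥ 1}` the last factor lies in `[1/4, 1]`, so the squared weight is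
comparable to `|y|^{-α-2}`. -/
lemma weight_sq {α : ℝ} {y : Plane} (hy : 0 < ‖y‖) :
    weight α y ^ 2 = ‖y‖ ^ (-α - 2) * (‖y‖ ^ α / (1 + ‖y‖ ^ α)) ^ 2 := by
  have h1 : (‖y‖ ^ ((α - 2) / 2)) ^ 2 = ‖y‖ ^ (-α - 2) * (‖y‖ ^ α) ^ 2 := by
    rw [← Real.rpow_natCast, ← Real.rpow_natCast, ← Real.rpow_mul hy.le, ← Real.rpow_mul hy.le,
      ← Real.rpow_add hy]
    congr 1; push_cast; ring
  rw [weight, div_pow, h1, div_pow]; ring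

lemma weight_sq_le {α : ℝ} {y : Plane} (hy : 1 ≤ ‖y‖) : weight α y ^ 2 ≤ ‖y‖ ^ (-α - 2) := by
  rw [weight_sq (by linarith)]
  refine mul_le_of_le_one_right (by positivity) (pow_le_one₀ (by positivity) ?_)
  rw [div_le_one (by positivity)]; linarith

lemma le_weight_sq {α : ℝ} (hα : 0 ≤ α) {y : Plane} (hy : 1 ≤ ‖y‖) :
    ‖y‖ ^ (-α - 2) ≤ 4 * weight α y ^ 2 := by
  rw [weight_sq (by linarith)]
  have h1 : 1 ≤ ‖y‖ ^ α := Real.one_le_rpow hy hα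
  have h2 : 1 / 2 ≤ ‖y‖ ^ α / (1 + ‖y‖ ^ α) := by
    rw [div_le_div_iff₀ (by norm_num) (by positivity)]; linarith
  have h3 : (1 / 2 : ℝ) ^ 2 ≤ (‖y‖ ^ α / (1 + ‖y‖ ^ α)) ^ 2 := by gcongr
  have h4 : 0 ≤ ‖y‖ ^ (-α - 2) := by positivity
  nlinarith

lemma tailIntegral_one_le {α : ℝ} (hα : 0 ≤ α) (u : Plane → ℝ) :
    tailIntegral α u 1 ≤ 4 * ∫⁻ y, ‖weight α y * u y‖ₑ ^ 2 := by
  rw [tailIntegral, ← lintegral_const_mul' _ _ (by simp)]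
  refine (setLIntegral_mono' (measurableSet_le_norm 1) fun y hy => ?_).trans
    (setLIntegral_le_lintegral _ _)
  rw [enorm_mul, mul_pow, ← mul_assoc, enorm_sq_eq_ofReal (weight α y), ← ENNReal.ofReal_ofNat 4,
    ← ENNReal.ofReal_mul (by norm_num)]
  gcongr
  exact le_weight_sq hα hy

lemma lintegral_weight_le_tailIntegral {α : ℝ} (u : Plane → ℝ) {R : ℝ} (hR : 1 ≤ R) :
    ∫⁻ y in {y | R ≤ ‖y‖}, ‖weight α y * u y‖ₑ ^ 2 ≤ tailIntegral α u R := by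
  refine setLIntegral_mono' (measurableSet_le_norm R) fun y hy => ?_
  rw [enorm_mul, mul_pow, enorm_sq_eq_ofReal (weight α y)]
  gcongr
  exact weight_sq_le (hR.trans hy)

/-- Uniform smallness of the tails: the factor `k 2^{-k}` tends to `0`. -/
theorem lintegral_weight_tail_le {α : ℝ} (hα : 2 ≤ α) {u : Plane → ℝ} {g : Plane → Plane}
    (hw : IsWeakGradient u g) (hu : MemL2Loc u) (hg : MemL2Loc g) (k : ℕ) :
    ∫⁻ y in {y | 2 ^ k ≤ ‖y‖}, ‖weight α y * u y‖ₑ ^ 2 ≤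
      2⁻¹ ^ k * (4 * (∫⁻ y, ‖weight α y * u y‖ₑ ^ 2) + k * ∫⁻ y, ‖g y‖ₑ ^ 2) := by
  refine (lintegral_weight_le_tailIntegral u (one_le_pow₀ (by norm_num))).trans
    ((tailIntegral_two_pow_le hα hw hu hg k).trans ?_)
  gcongr
  exact tailIntegral_one_le (by linarith) u

/-- The `H_α` norm controls the unweighted `L²` norm on every disc, also where the weight
degenerates. -/
theorem lintegral_ball_le {α : ℝ} (hα : 2 ≤ α) {u : Plane → ℝ} {g : Plane → Plane}
    (hw : IsWeakGradient u g) (hu : MemL2Loc u) (hg : MemL2Loc g) {R : ℝ} (hR : 1 ≤ R) :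
    ∫⁻ y in ball 0 R, ‖u y‖ₑ ^ 2 ≤
      ENNReal.ofReal (4 * (2 * R) ^ (α + 2)) * (∫⁻ y, ‖weight α y * u y‖ₑ ^ 2) +
      ENNReal.ofReal (4 * R ^ 2) * ∫⁻ y, ‖g y‖ₑ ^ 2 := by
  refine (lintegral_ball_le_annulus hw hu hg (by linarith)).trans ?_
  gcongr
  rw [← lintegral_const_mul' _ _ ENNReal.ofReal_ne_top]
  refine (setLIntegral_mono' (measurableSet_ball.diff measurableSet_ball) fun y hy => ?_).trans
    (setLIntegral_le_lintegral _ _)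
  have h1 : ‖y‖ < 2 * R := mem_ball_zero_iff.1 hy.1
  have h2 : R ≤ ‖y‖ := not_lt.1 fun h => hy.2 (mem_ball_zero_iff.2 h)
  have hy0 : 0 < ‖y‖ := by linarith
  rw [enorm_mul, mul_pow, ← mul_assoc, enorm_sq_eq_ofReal (weight α y),
    ← ENNReal.ofReal_mul (by positivity)]
  refine le_mul_of_one_le_left' (ENNReal.one_le_ofReal.2 ?_)
  calc (1 : ℝ) = ‖y‖ ^ (α + 2) * ‖y‖ ^ (-α - 2) := by
        rw [← Real.rpow_add hy0]; ring_nf; simp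
    _ ≤ (2 * R) ^ (α + 2) * (4 * weight α y ^ 2) := by
        gcongr
        exact le_weight_sq (by linarith) (hR.trans h2)
    _ = _ := by ring

/-! ### Grid averages -/

/-- The half-open square of side `a` with lower left corner `a k`, for `k ∈ ℤ²`. -/
def gridCell (a : ℝ) (k : Fin 2 → ℤ) : Set Plane := {y | ∀ i, ⌊y i / a⌋ = k i}

lemma measurableSet_gridCell (a : ℝ) (k : Fin 2 → ℤ) : MeasurableSet (gridCell a k) := by
  have : gridCell a k = ⋂ i, (fun y : Plane => ⌊y i / a⌋) ⁻¹' {k i} := by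
    ext y; simp [gridCell]
  rw [this]
  exact MeasurableSet.iInter fun i => (by fun_prop : Measurable fun y : Plane => ⌊y i / a⌋)
    (measurableSet_singleton _)

lemma pairwiseDisjoint_gridCell (a : ℝ) (s : Set (Fin 2 → ℤ)) :
    s.PairwiseDisjoint (gridCell a) := by
  intro k _ l _ hkl
  refine Set.disjoint_left.2 fun y hk hl => hkl (funext fun i => ?_)
  rw [← hk i, ← hl i]

lemma volume_gridCell {a : ℝ} (ha : 0 < a) (k : Fin 2 → ℤ) :
    volume (gridCell a k) = ENNReal.ofReal (a ^ 2) := by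
  have h : gridCell a k =
      WithLp.ofLp ⁻¹' (pi univ fun i => Ico (a * k i) (a * (k i + 1))) := by
    ext y
    simp only [gridCell, mem_ofPred_eq, mem_preimage, Set.mem_pi, mem_univ, true_implies, mem_Ico]
    refine forall_congr' fun i => ?_
    rw [Int.floor_eq_iff, le_div_iff₀ ha, div_lt_iff₀ ha, mul_comm a, mul_comm a]
  have hpi : MeasurableSet (pi univ fun i => Ico (a * (k i : ℝ)) (a * (k i + 1))) :=
    MeasurableSet.univ_pi fun _ => measurableSet_Ico
  rw [h, (PiLp.volume_preserving_ofLp (Fin 2)).measure_preimage hpi.nullMeasurableSet,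
    Real.volume_pi_Ico, Fin.prod_univ_two, ← ENNReal.ofReal_mul (by linarith)]
  congr 1
  ring

lemma norm_sub_le_of_mem_gridCell {a : ℝ} (ha : 0 < a) {k : Fin 2 → ℤ} {x y : Plane}
    (hx : x ∈ gridCell a k) (hy : y ∈ gridCell a k) : ‖x - y‖ ≤ 2 * a := by
  have h : ∀ i, |x i - y i| ≤ a := by
    intro i
    have h1 := Int.abs_sub_lt_one_of_floor_eq_floor ((hx i).trans (hy i).symm)
    rw [← sub_div, abs_div, abs_of_pos ha, div_lt_one ha] at h1
    exact h1.le
  rw [EuclideanSpace.norm_eq, Fin.sum_univ_two]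
  refine Real.sqrt_le_iff.2 ⟨by positivity, ?_⟩
  have h0 := h 0
  have h1 := h 1
  simp only [PiLp.sub_apply, Real.norm_eq_abs]
  nlinarith [abs_nonneg (x 0 - y 0), abs_nonneg (x 1 - y 1)]

lemma exists_finset_ball_subset_gridCell {a : ℝ} (ha : 0 < a) (R : ℝ) :
    ∃ F : Finset (Fin 2 → ℤ), ball (0 : Plane) R ⊆ ⋃ k ∈ F, gridCell a k := by
  refine ⟨Fintype.piFinset fun _ => Finset.Icc (-⌈R / a⌉) ⌈R / a⌉, fun y hy => ?_⟩
  simp only [mem_iUnion]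
  refine ⟨fun i => ⌊y i / a⌋, ?_, fun i => rfl⟩
  rw [Fintype.mem_piFinset]
  intro i
  have h1 : |y i / a| ≤ R / a := by
    rw [abs_div, abs_of_pos ha]
    gcongr
    exact (PiLp.norm_apply_le y i).trans (mem_ball_zero_iff.1 hy).le
  have h2 := (abs_le.1 (h1.trans (Int.le_ceil _)))
  rw [Finset.mem_Icc, Int.le_floor]
  refine ⟨by push_cast; exact h2.1, ?_⟩
  exact Int.cast_le.1 ((Int.floor_le _).trans h2.2)

lemma lintegral_translation_le {u : Plane → ℝ} {g : Plane → Plane}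
    (hw : IsWeakGradient u g) (hu : MemL2Loc u) (hg : MemL2Loc g) (h : Plane) :
    ∫⁻ y, ‖u (y + h) - u y‖ₑ ^ 2 ≤ ‖h‖ₑ ^ 2 * ∫⁻ y, ‖g y‖ₑ ^ 2 := by
  have := lintegral_sub_comp_le hw hu hg le_rfl h (ρ := 1) measurable_one (by simp)
    (M := ‖h‖ₑ ^ 2) (by simp) (by simp)
  simpa using this

/-- Averaging the translation estimate over all translations of length at most `r`. -/
lemma lintegral_near_diagonal_le {u : Plane → ℝ} {g : Plane → Plane} (hum : Measurable u)
    (hw : IsWeakGradient u g) (hu : MemL2Loc u) (hg : MemL2Loc g) {r : ℝ} (hr : 0 ≤ r) :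
    ∫⁻ y, ∫⁻ x in closedBall y r, ‖u x - u y‖ₑ ^ 2 ≤
      ENNReal.ofReal (r ^ 4) * volume (ball (0 : Plane) 1) * ∫⁻ y, ‖g y‖ₑ ^ 2 := by
  have hshift : ∀ y, ∫⁻ x in closedBall y r, ‖u x - u y‖ₑ ^ 2 =
      ∫⁻ h in closedBall (0 : Plane) r, ‖u (y + h) - u y‖ₑ ^ 2 := by
    intro y
    rw [← lintegral_indicator measurableSet_closedBall,
      ← lintegral_indicator measurableSet_closedBall, ← lintegral_add_left_eq_self _ y]
    refine lintegral_congr fun h => ?_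
    simp [indicator, dist_eq_norm]
  simp only [hshift]
  rw [lintegral_lintegral_swap (by fun_prop)]
  calc _ ≤ ∫⁻ h in closedBall (0 : Plane) r, ENNReal.ofReal (r ^ 2) * ∫⁻ y, ‖g y‖ₑ ^ 2 := by
        refine setLIntegral_mono' measurableSet_closedBall fun h hh => ?_
        refine (lintegral_translation_le hw hu hg h).trans ?_
        gcongr
        rw [← enorm_norm h, enorm_sq_eq_ofReal]
        have := mem_closedBall_zero_iff.1 hh
        gcongr
    _ = _ := by
        rw [setLIntegral_const, Measure.addHaar_closedBall _ _ hr]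
        simp only [finrank_euclideanSpace, Fintype.card_fin]
        rw [show r ^ 4 = r ^ 2 * r ^ 2 by ring, ENNReal.ofReal_mul (by positivity)]
        ring

lemma integrableOn_gridCell {u : Plane → ℝ} (hu : MemL2Loc u) {a : ℝ} (ha : 0 < a)
    (k : Fin 2 → ℤ) : IntegrableOn u (gridCell a k) := by
  rcases (gridCell a k).eq_empty_or_nonempty with h | ⟨x, hx⟩
  · simp [h]
  · refine (hu.locallyIntegrable.integrableOn_isCompact (isCompact_closedBall x (2 * a))).mono_set ?_
    intro y hy
    rw [mem_closedBall, dist_eq_norm]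
    exact norm_sub_le_of_mem_gridCell ha hy hx

/-- `u` is compared with its average over the cell, using that a cell lies in the disc of radius
`2 a` around each of its points. -/
lemma lintegral_gridCell_le {u : Plane → ℝ} (hum : Measurable u) (hu : MemL2Loc u) {a : ℝ}
    (ha : 0 < a) (k : Fin 2 → ℤ) :
    ENNReal.ofReal (a ^ 2) * ∫⁻ y in gridCell a k, ‖u y‖ₑ ^ 2 ≤
      2 * (∫⁻ y in gridCell a k, ∫⁻ x in closedBall y (2 * a), ‖u x - u y‖ₑ ^ 2) +
      2 * ‖∫ x in gridCell a k, u x‖ₑ ^ 2 := by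
  have hint := integrableOn_gridCell hu ha k
  have hvol := volume_gridCell ha k
  set Q := gridCell a k with hQ
  have hQm : MeasurableSet Q := measurableSet_gridCell a k
  have hvr : volume.real Q = a ^ 2 := by
    rw [Measure.real, hvol, ENNReal.toReal_ofReal (by positivity)]
  set m := ENNReal.ofReal (a ^ 2) with hm
  have hm0 : m ≠ 0 := by rw [hm]; simp [ha.ne']
  have hmt : m ≠ ⊤ := ENNReal.ofReal_ne_top
  have hpt : ∀ y ∈ Q, m ^ 2 * ‖u y‖ₑ ^ 2 ≤ 2 * ‖∫ x in Q, u x‖ₑ ^ 2 +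
      2 * (m * ∫⁻ x in closedBall y (2 * a), ‖u x - u y‖ₑ ^ 2) := by
    intro y hy
    have hi : ∫ x in Q, (u x - u y) = (∫ x in Q, u x) - a ^ 2 * u y := by
      rw [integral_sub hint (integrableOn_const (by rw [hvol]; exact ENNReal.ofReal_ne_top)),
        setIntegral_const, hvr, smul_eq_mul]
    have h1 := enorm_sq_le_two_mul (a ^ 2 * u y) (∫ x in Q, u x)
    rw [← hi, enorm_mul, mul_pow, Real.enorm_of_nonneg (by positivity)] at h1
    refine h1.trans ?_
    gcongr
    calc ‖∫ x in Q, (u x - u y)‖ₑ ^ 2 ≤ (∫⁻ x in Q, ‖u x - u y‖ₑ) ^ 2 := by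
          gcongr; exact enorm_integral_le_lintegral_enorm _
      _ ≤ m * ∫⁻ x in Q, ‖u x - u y‖ₑ ^ 2 := by
          rw [← hvol, ← Measure.restrict_apply_univ]
          exact sq_lintegral_le (by fun_prop)
      _ ≤ _ := by
          gcongr
          intro x hx
          rw [mem_closedBall, dist_eq_norm]
          exact norm_sub_le_of_mem_gridCell ha hx hy
  have h2 := setLIntegral_mono' (μ := volume) hQm hpt
  rw [lintegral_const_mul' _ _ (by finiteness), lintegral_add_left measurable_const,
    setLIntegral_const, hvol, lintegral_const_mul' _ _ (by simp), lintegral_const_mul' _ _ hmt] at h2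
  refine (ENNReal.mul_le_mul_iff_right hm0 hmt).1 ?_
  calc _ = m ^ 2 * ∫⁻ y in Q, ‖u y‖ₑ ^ 2 := by ring
    _ ≤ _ := h2
    _ = _ := by ring

/-- Poincaré's inequality summed over finitely many cells. The constant does not depend on the number
of cells, since pairs of points in a common cell are at distance at most `2 a`. -/
theorem lintegral_iUnion_gridCell_le {u : Plane → ℝ} {g : Plane → Plane} (hum : Measurable u)
    (hw : IsWeakGradient u g) (hu : MemL2Loc u) (hg : MemL2Loc g) {a : ℝ} (ha : 0 < a)
    (F : Finset (Fin 2 → ℤ)) :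
    ENNReal.ofReal (a ^ 2) * ∫⁻ y in ⋃ k ∈ F, gridCell a k, ‖u y‖ₑ ^ 2 ≤
      ENNReal.ofReal (32 * a ^ 4) * volume (ball (0 : Plane) 1) * (∫⁻ y, ‖g y‖ₑ ^ 2) +
      2 * ∑ k ∈ F, ‖∫ x in gridCell a k, u x‖ₑ ^ 2 := by
  have hsplit := fun f : Plane → ℝ≥0∞ => lintegral_biUnion_finset (μ := volume)
    (pairwiseDisjoint_gridCell a F) (fun k _ => measurableSet_gridCell a k) f
  rw [hsplit, Finset.mul_sum]
  calc _ ≤ ∑ k ∈ F, (2 * (∫⁻ y in gridCell a k, ∫⁻ x in closedBall y (2 * a), ‖u x - u y‖ₑ ^ 2) +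
      2 * ‖∫ x in gridCell a k, u x‖ₑ ^ 2) :=
        Finset.sum_le_sum fun k _ => lintegral_gridCell_le hum hu ha k
    _ = 2 * (∫⁻ y in ⋃ k ∈ F, gridCell a k, ∫⁻ x in closedBall y (2 * a), ‖u x - u y‖ₑ ^ 2) +
      2 * ∑ k ∈ F, ‖∫ x in gridCell a k, u x‖ₑ ^ 2 := by
        rw [Finset.sum_add_distrib, ← Finset.mul_sum, ← Finset.mul_sum, hsplit]
    _ ≤ 2 * (ENNReal.ofReal ((2 * a) ^ 4) * volume (ball (0 : Plane) 1) * ∫⁻ y, ‖g y‖ₑ ^ 2) +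
      2 * ∑ k ∈ F, ‖∫ x in gridCell a k, u x‖ₑ ^ 2 := by
        gcongr
        exact (setLIntegral_le_lintegral _ _).trans
          (lintegral_near_diagonal_le hum hw hu hg (by positivity))
    _ = _ := by
        rw [show 32 * a ^ 4 = 2 * (2 * a) ^ 4 by ring, ENNReal.ofReal_mul (by norm_num),
          ENNReal.ofReal_ofNat]
        ring

/-! ### Total boundedness of the image of the unit ball -/

/-- A compactness criterion of Ehrling type: `T` maps the unit ball to a totally bounded set if, up to
an arbitrarily small multiple of `‖u‖`, the norm of `T u` is controlled by finitely many bounded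
linear functionals of `u`. -/
theorem totallyBounded_image_closedBall {E F : Type*} [SeminormedAddCommGroup E] [NormedSpace ℝ E]
    [SeminormedAddCommGroup F] [NormedSpace ℝ F] (T : E →ₗ[ℝ] F)
    (h : ∀ ε > 0, ∃ (ι : Type) (_ : Fintype ι) (L : E →ₗ[ℝ] (ι → ℝ)) (K C : ℝ),
      (∀ u, ‖L u‖ ≤ K * ‖u‖) ∧ ∀ u, ‖T u‖ ^ 2 ≤ ε * ‖u‖ ^ 2 + C * ‖L u‖ ^ 2) :
    TotallyBounded (T '' closedBall 0 1) := by
  rw [Metric.totallyBounded_iff]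
  intro δ hδ
  -- points of the unit ball are at distance at most `2`, so `ε = δ² / 8` costs at most `δ² / 2`
  obtain ⟨ι, _, L, K, C, hL, hT⟩ := h (δ ^ 2 / 8) (by positivity)
  have hb : Bornology.IsBounded (L '' closedBall 0 1) := by
    rw [isBounded_iff_forall_norm_le]
    refine ⟨|K|, ?_⟩
    rintro _ ⟨u, hu, rfl⟩
    rw [mem_closedBall_zero_iff] at hu
    calc ‖L u‖ ≤ K * ‖u‖ := hL u
      _ ≤ |K| * ‖u‖ := by gcongr; exact le_abs_self K
      _ ≤ |K| := mul_le_of_le_one_right (abs_nonneg K) hu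
  set η := δ / (2 * (|C| + 1)) with hη
  have hη0 : 0 < η := by positivity
  obtain ⟨t, hts, htf, hcov⟩ := Metric.finite_approx_of_totallyBounded
    (hb.isCompact_closure.totallyBounded.subset subset_closure) η hη0
  choose! p hp using fun z (hz : z ∈ t) => hts hz
  refine ⟨(fun z => T (p z)) '' t, htf.image _, ?_⟩
  rintro _ ⟨u, hu, rfl⟩
  obtain ⟨z, hz, huz⟩ := mem_iUnion₂.1 (hcov (mem_image_of_mem L hu))
  refine mem_iUnion₂.2 ⟨_, mem_image_of_mem _ hz, ?_⟩
  obtain ⟨hpz, hLz⟩ := hp z hz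
  rw [mem_closedBall_zero_iff] at hu hpz
  rw [mem_ball, dist_eq_norm] at huz ⊢
  have h1 : ‖u - p z‖ ≤ 2 := (norm_sub_le _ _).trans (by linarith)
  have h2 : ‖L (u - p z)‖ < η := by rwa [map_sub, hLz]
  have h3 := hT (u - p z)
  rw [map_sub] at h3
  have h4 : ‖u - p z‖ ^ 2 ≤ 2 ^ 2 := by gcongr
  have h5 : C * ‖L (u - p z)‖ ^ 2 ≤ δ ^ 2 / 4 := by
    calc C * ‖L (u - p z)‖ ^ 2 ≤ (|C| + 1) ^ 2 * η ^ 2 := by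
          gcongr
          nlinarith [le_abs_self C, abs_nonneg C]
      _ = δ ^ 2 / 4 := by rw [hη]; field_simp; norm_num
  refine lt_of_pow_lt_pow_left₀ 2 hδ.le ?_
  nlinarith [sq_pos_of_pos hδ]

lemma HSpace.norm_sq_eq (α : ℝ) (u : HSpace α) :
    ENNReal.ofReal (‖u‖ ^ 2) = (∫⁻ y, ‖weakGradient u.1 y‖ₑ ^ 2) +
      ∫⁻ y, ‖weight α y * (u.1 : Plane →ₘ[volume] ℝ) y‖ₑ ^ 2 := by
  rw [HSpace.norm_eq, Real.sq_sqrt (by positivity), ENNReal.ofReal_add (by positivity)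
    (by positivity), ENNReal.ofReal_pow (by positivity), ENNReal.ofReal_pow (by positivity),
    ENNReal.ofReal_toReal u.2.1.2.ne, ENNReal.ofReal_toReal u.2.2.2.ne, lintegral_enorm_sq,
    lintegral_enorm_sq]
  rfl

lemma LSpace.norm_sq_eq (α : ℝ) (u : LSpace α) :
    ENNReal.ofReal (‖u‖ ^ 2) = ∫⁻ y, ‖weight α y * (u.1 : Plane →ₘ[volume] ℝ) y‖ₑ ^ 2 := by
  rw [LSpace.norm_eq, ENNReal.ofReal_pow (by positivity), ENNReal.ofReal_toReal u.2.2.ne,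
    lintegral_enorm_sq]
  rfl

lemma HSpace.lintegral_gradient_le (α : ℝ) (u : HSpace α) :
    ∫⁻ y, ‖weakGradient u.1 y‖ₑ ^ 2 ≤ ENNReal.ofReal (‖u‖ ^ 2) := by
  rw [HSpace.norm_sq_eq]; exact le_self_add

lemma HSpace.lintegral_weight_le (α : ℝ) (u : HSpace α) :
    ∫⁻ y, ‖weight α y * (u.1 : Plane →ₘ[volume] ℝ) y‖ₑ ^ 2 ≤ ENNReal.ofReal (‖u‖ ^ 2) := by
  rw [HSpace.norm_sq_eq]; exact le_add_self

lemma HSpace.measurable_coe {α : ℝ} (u : HSpace α) :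
    Measurable (u.1 : Plane →ₘ[volume] ℝ) := AEEqFun.measurable _

theorem HSpace.exists_lintegral_ball_le {α : ℝ} (hα : 2 ≤ α) (R : ℝ) :
    ∃ K : ℝ, 0 ≤ K ∧ ∀ u : HSpace α,
      ∫⁻ y in ball 0 R, ‖(u.1 : Plane →ₘ[volume] ℝ) y‖ₑ ^ 2 ≤ ENNReal.ofReal (K * ‖u‖ ^ 2) := by
  set r := max R 1 with hr
  have hr1 : 1 ≤ r := le_max_right _ _
  refine ⟨4 * (2 * r) ^ (α + 2) + 4 * r ^ 2, by positivity, fun u => ?_⟩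
  calc _ ≤ ∫⁻ y in ball 0 r, ‖(u.1 : Plane →ₘ[volume] ℝ) y‖ₑ ^ 2 :=
        lintegral_mono_set (ball_subset_ball (le_max_left _ _))
    _ ≤ ENNReal.ofReal (4 * (2 * r) ^ (α + 2)) * ENNReal.ofReal (‖u‖ ^ 2) +
        ENNReal.ofReal (4 * r ^ 2) * ENNReal.ofReal (‖u‖ ^ 2) := by
        refine (lintegral_ball_le hα (isWeakGradient_weakGradient u.1) u.1.2.1
          (memL2Loc_weakGradient u.1) hr1).trans ?_
        gcongr
        · exact HSpace.lintegral_weight_le α u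
        · exact HSpace.lintegral_gradient_le α u
    _ = _ := by
        rw [← add_mul, ← ENNReal.ofReal_add (by positivity) (by positivity),
          ← ENNReal.ofReal_mul (by positivity)]

/-- The integrals of `u` over finitely many cells of the grid of side `a`, as a linear map. -/
noncomputable def cellIntegrals (α : ℝ) {a : ℝ} (ha : 0 < a) (F : Finset (Fin 2 → ℤ)) :
    HSpace α →ₗ[ℝ] (F → ℝ) where
  toFun u k := ∫ x in gridCell a k, (u.1 : Plane →ₘ[volume] ℝ) x
  map_add' u v := by
    ext k
    rw [Pi.add_apply, ← integral_add (integrableOn_gridCell u.1.2.1 ha k)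
      (integrableOn_gridCell v.1.2.1 ha k)]
    exact integral_congr_ae (ae_restrict_of_ae (AEEqFun.coeFn_add _ _))
  map_smul' c u := by
    ext k
    simp only [Pi.smul_apply, smul_eq_mul, RingHom.id_apply]
    rw [← integral_const_mul]
    exact integral_congr_ae (ae_restrict_of_ae (AEEqFun.coeFn_smul _ _))

lemma exists_cellIntegrals_bound {α : ℝ} (hα : 2 ≤ α) {a : ℝ} (ha : 0 < a)
    (F : Finset (Fin 2 → ℤ)) :
    ∃ K : ℝ, ∀ u : HSpace α, ‖cellIntegrals α ha F u‖ ≤ K * ‖u‖ := by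
  have hR : ∃ R, ∀ k ∈ F, gridCell a k ⊆ ball 0 R := by
    have hb : Bornology.IsBounded (⋃ k ∈ F, gridCell a k) := by
      refine (Bornology.isBounded_biUnion_finset F).2 fun k _ => ?_
      rw [Metric.isBounded_iff]
      exact ⟨2 * a, fun x hx y hy => by
        rw [dist_eq_norm]; exact norm_sub_le_of_mem_gridCell ha hx hy⟩
    obtain ⟨R, hR⟩ := hb.subset_ball 0
    exact ⟨R, fun k hk => (subset_biUnion_of_mem (u := gridCell a) hk).trans hR⟩
  obtain ⟨R, hR⟩ := hR
  obtain ⟨K, hK0, hK⟩ := HSpace.exists_lintegral_ball_le hα R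
  refine ⟨a * Real.sqrt K, fun u => ?_⟩
  refine (pi_norm_le_iff_of_nonneg (by positivity)).2 fun k => ?_
  refine (pow_le_pow_iff_left₀ (norm_nonneg _) (by positivity) two_ne_zero).1 ?_
  have h1 : ‖∫ x in gridCell a k, (u.1 : Plane →ₘ[volume] ℝ) x‖ₑ ^ 2 ≤
      ENNReal.ofReal (a ^ 2) * ENNReal.ofReal (K * ‖u‖ ^ 2) := by
    calc _ ≤ (∫⁻ x in gridCell a k, ‖(u.1 : Plane →ₘ[volume] ℝ) x‖ₑ) ^ 2 := by
          gcongr; exact enorm_integral_le_lintegral_enorm _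
      _ ≤ volume (gridCell a k) *
          ∫⁻ x in gridCell a k, ‖(u.1 : Plane →ₘ[volume] ℝ) x‖ₑ ^ 2 := by
          rw [← Measure.restrict_apply_univ]
          exact sq_lintegral_le (HSpace.measurable_coe u).enorm.aemeasurable
      _ ≤ _ := by
          rw [volume_gridCell ha]
          gcongr
          exact (lintegral_mono_set (hR k k.2)).trans (hK u)
  rw [enorm_sq_eq_ofReal, ← ENNReal.ofReal_mul (by positivity),
    ENNReal.ofReal_le_ofReal_iff (by positivity)] at h1
  rw [mul_pow, mul_pow, Real.sq_sqrt hK0, Real.norm_eq_abs, sq_abs]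
  simpa [cellIntegrals, mul_assoc] using h1

/-- The hypothesis of the Ehrling criterion for the embedding: outside a large disc the weighted norm
is small, and on the disc `u` is close to its averages over a fine grid. -/
theorem norm_embedding_sq_le {α : ℝ} (hα : 2 ≤ α) {ε : ℝ} (hε : 0 < ε) :
    ∃ (a : ℝ) (ha : 0 < a) (F : Finset (Fin 2 → ℤ)) (C : ℝ), ∀ u : HSpace α,
      ‖embedding α u‖ ^ 2 ≤ ε * ‖u‖ ^ 2 + C * ‖cellIntegrals α ha F u‖ ^ 2 := by
  set c := volume.real (ball (0 : Plane) 1) with hc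
  have hcE : volume (ball (0 : Plane) 1) = ENNReal.ofReal c :=
    (ENNReal.ofReal_toReal measure_ball_lt_top.ne).symm
  have hc0 : 0 ≤ c := measureReal_nonneg
  obtain ⟨n, hn⟩ : ∃ n : ℕ, (1 / 2 : ℝ) ^ n * (4 + n) ≤ ε / 2 := by
    have h1 : Tendsto (fun n : ℕ => (1 / 2 : ℝ) ^ n * (4 + n)) atTop (𝓝 0) := by
      have h2 := (tendsto_pow_atTop_nhds_zero_of_lt_one (r := (1 / 2 : ℝ)) (by norm_num)
        (by norm_num)).mul_const 4
      have h3 := tendsto_self_mul_const_pow_of_lt_one (r := (1 / 2 : ℝ)) (by norm_num)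
        (by norm_num)
      refine ((h2.add h3).congr fun n => by ring).trans (by simp)
    exact (h1.eventually_le_const (by positivity)).exists
  obtain ⟨a, ha, hac⟩ : ∃ a : ℝ, 0 < a ∧ 32 * a ^ 2 * c ≤ ε / 2 := by
    refine ⟨Real.sqrt (ε / (64 * (c + 1))), by positivity, ?_⟩
    rw [Real.sq_sqrt (by positivity), mul_div_assoc', div_mul_eq_mul_div,
      div_le_div_iff₀ (by positivity) (by norm_num)]
    nlinarith
  obtain ⟨F, hF⟩ := exists_finset_ball_subset_gridCell ha (2 ^ n)
  refine ⟨a, ha, F, 2 * F.card / a ^ 2, fun u => ?_⟩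
  set v : Plane → ℝ := ⇑(u.1 : Plane →ₘ[volume] ℝ) with hv
  have hw := isWeakGradient_weakGradient u.1
  have hu : MemL2Loc v := u.1.2.1
  have hg := memL2Loc_weakGradient u.1
  have hG := HSpace.lintegral_gradient_le α u
  have hN := HSpace.lintegral_weight_le α u
  set S := ∑ k ∈ F, (∫ x in gridCell a k, v x) ^ 2 with hS
  have hS0 : 0 ≤ S := Finset.sum_nonneg fun _ _ => sq_nonneg _
  have hSle : S ≤ F.card * ‖cellIntegrals α ha F u‖ ^ 2 := by
    rw [← nsmul_eq_mul]
    refine Finset.sum_le_card_nsmul _ _ _ fun k hk => ?_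
    have := norm_le_pi_norm (cellIntegrals α ha F u) ⟨k, hk⟩
    rw [← sq_abs]
    gcongr
    exact this
  have hhead : ∫⁻ y in ball 0 (2 ^ n), ‖weight α y * v y‖ₑ ^ 2 ≤
      ENNReal.ofReal (ε / 2 * ‖u‖ ^ 2 + 2 / a ^ 2 * S) := by
    have h1 := lintegral_iUnion_gridCell_le (HSpace.measurable_coe u) hw hu hg ha F
    have h2 : ENNReal.ofReal (a ^ 2) * ∫⁻ y in ball 0 (2 ^ n), ‖weight α y * v y‖ₑ ^ 2 ≤
        ENNReal.ofReal (a ^ 2) * ENNReal.ofReal (ε / 2 * ‖u‖ ^ 2 + 2 / a ^ 2 * S) := by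
      calc _ ≤ ENNReal.ofReal (a ^ 2) * ∫⁻ y in ⋃ k ∈ F, gridCell a k, ‖v y‖ₑ ^ 2 := by
            gcongr
            rw [enorm_mul]
            refine mul_le_of_le_one_left' ?_
            rw [Real.enorm_of_nonneg (weight_nonneg α y)]
            exact ENNReal.ofReal_le_one.2 (weight_le_one hα y)
        _ ≤ _ := h1
        _ ≤ ENNReal.ofReal (32 * a ^ 4) * ENNReal.ofReal c * ENNReal.ofReal (‖u‖ ^ 2) +
            2 * ENNReal.ofReal S := by
            rw [hcE, hS, ENNReal.ofReal_sum_of_nonneg fun _ _ => sq_nonneg _]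
            gcongr with k hk
            exact (enorm_sq_eq_ofReal _).le
        _ = ENNReal.ofReal (a ^ 2 * (32 * a ^ 2 * c * ‖u‖ ^ 2 + 2 / a ^ 2 * S)) := by
            rw [← ENNReal.ofReal_mul (by positivity), ← ENNReal.ofReal_mul (by positivity),
              ← ENNReal.ofReal_ofNat 2, ← ENNReal.ofReal_mul (by positivity),
              ← ENNReal.ofReal_add (by positivity) (by positivity)]
            congr 1
            field_simp
        _ ≤ _ := by
            rw [ENNReal.ofReal_mul (by positivity)]
            gcongr
    exact (ENNReal.mul_le_mul_iff_right (by simp [ha.ne']) ENNReal.ofReal_ne_top).1 h2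
  have htail : ∫⁻ y in {y | 2 ^ n ≤ ‖y‖}, ‖weight α y * v y‖ₑ ^ 2 ≤
      ENNReal.ofReal (ε / 2 * ‖u‖ ^ 2) := by
    refine (lintegral_weight_tail_le hα hw hu hg n).trans ?_
    calc _ ≤ 2⁻¹ ^ n * (4 * ENNReal.ofReal (‖u‖ ^ 2) + n * ENNReal.ofReal (‖u‖ ^ 2)) := by
          gcongr
      _ = ENNReal.ofReal ((1 / 2) ^ n * (4 + n) * ‖u‖ ^ 2) := by
          rw [ENNReal.ofReal_mul (by positivity), ENNReal.ofReal_mul (by positivity),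
            ENNReal.ofReal_add (by positivity) (by positivity),
            ENNReal.ofReal_pow (p := (1 / 2 : ℝ)) (by positivity), one_div,
            ENNReal.ofReal_inv_of_pos (by norm_num), ENNReal.ofReal_natCast,
            ENNReal.ofReal_ofNat, ENNReal.ofReal_ofNat]
          ring
      _ ≤ _ := by gcongr
  have hsplit : ∫⁻ y, ‖weight α y * v y‖ₑ ^ 2 =
      (∫⁻ y in ball 0 (2 ^ n), ‖weight α y * v y‖ₑ ^ 2) +
      ∫⁻ y in {y | 2 ^ n ≤ ‖y‖}, ‖weight α y * v y‖ₑ ^ 2 := by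
    rw [← lintegral_add_compl _ (measurableSet_ball (x := (0 : Plane)) (ε := 2 ^ n))]
    congr 4
    ext y; simp
  have hE : ENNReal.ofReal (‖embedding α u‖ ^ 2) ≤
      ENNReal.ofReal (ε * ‖u‖ ^ 2 + 2 / a ^ 2 * S) := by
    rw [LSpace.norm_sq_eq]
    refine (hsplit.le.trans (add_le_add hhead htail)).trans ?_
    rw [← ENNReal.ofReal_add (by positivity) (by positivity)]
    exact ENNReal.ofReal_le_ofReal (by linarith)
  rw [ENNReal.ofReal_le_ofReal_iff (by positivity)] at hE
  refine hE.trans ?_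
  calc _ ≤ ε * ‖u‖ ^ 2 + 2 / a ^ 2 * (F.card * ‖cellIntegrals α ha F u‖ ^ 2) := by gcongr
    _ = _ := by ring

theorem totallyBounded_embedding_image {α : ℝ} (hα : 2 ≤ α) :
    TotallyBounded (embedding α '' closedBall 0 1) := by
  refine totallyBounded_image_closedBall (embedding α : HSpace α →ₗ[ℝ] LSpace α) fun ε hε => ?_
  obtain ⟨a, ha, F, C, hC⟩ := norm_embedding_sq_le hα hε
  obtain ⟨K, hK⟩ := exists_cellIntegrals_bound hα ha F
  exact ⟨F, inferInstance, cellIntegrals α ha F, K, C, hK, hC⟩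

/-! ### Completeness of `H_α` -/

lemma tendsto_integral_mul_of_tendsto_L2_ball {f : ℕ → Plane → ℝ} {f₀ ψ : Plane → ℝ} {R : ℝ}
    (hf : ∀ n, MemL2Loc (f n)) (hf₀ : MemL2Loc f₀) (hψ : Continuous ψ)
    (hc : HasCompactSupport ψ) (hR : tsupport ψ ⊆ ball 0 R)
    (h : Tendsto (fun n => ∫⁻ y in ball 0 R, ‖f n y - f₀ y‖ₑ ^ 2) atTop (𝓝 0)) :
    Tendsto (fun n => ∫ y, f n y * ψ y) atTop (𝓝 (∫ y, f₀ y * ψ y)) := by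
  have hi : ∀ {v : Plane → ℝ}, MemL2Loc v → Integrable (fun y => v y * ψ y) volume := fun hv =>
    hv.locallyIntegrable.integrable_smul_right_of_hasCompactSupport hψ hc
  refine tendsto_integral_of_L1 _ (hi hf₀).aestronglyMeasurable (.of_forall fun n => hi (hf n)) ?_
  obtain ⟨C, hC⟩ := hψ.bounded_above_of_compact_support hc
  have hbound : ∀ n, ∫⁻ y, ‖f n y * ψ y - f₀ y * ψ y‖ₑ ≤
      (volume (ball (0 : Plane) R) * ∫⁻ y in ball 0 R, ‖f n y - f₀ y‖ₑ ^ 2) ^ (1 / 2 : ℝ) *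
        ENNReal.ofReal C := by
    intro n
    calc _ ≤ ∫⁻ y in ball 0 R, ‖f n y - f₀ y‖ₑ * ENNReal.ofReal C := by
          rw [← lintegral_indicator measurableSet_ball]
          refine lintegral_mono fun y => ?_
          by_cases hy : y ∈ ball (0 : Plane) R
          · rw [indicator_of_mem hy, ← sub_mul, enorm_mul]
            gcongr
            rw [← ofReal_norm]
            exact ENNReal.ofReal_le_ofReal (hC y)
          · have : ψ y = 0 := image_eq_zero_of_notMem_tsupport fun h => hy (hR h)
            simp [this]
      _ = (∫⁻ y in ball 0 R, ‖f n y - f₀ y‖ₑ) * ENNReal.ofReal C :=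
          lintegral_mul_const' _ _ ENNReal.ofReal_ne_top
      _ ≤ _ := by
          gcongr
          rw [one_div, ENNReal.le_rpow_inv_iff (by norm_num), ENNReal.rpow_ofNat,
            ← Measure.restrict_apply_univ]
          refine sq_lintegral_le ?_
          exact ((hf n).locallyIntegrable.aestronglyMeasurable.sub
            hf₀.locallyIntegrable.aestronglyMeasurable).enorm.restrict
  refine tendsto_of_tendsto_of_tendsto_of_le_of_le tendsto_const_nhds ?_ (fun _ => zero_le) hbound
  have h1 := ENNReal.Tendsto.const_mul (a := volume (ball (0 : Plane) R)) h
    (.inr measure_ball_lt_top.ne)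
  have h2 := ((ENNReal.continuous_rpow_const (y := 1 / 2)).tendsto _).comp h1
  have h3 := ENNReal.Tendsto.mul_const h2 (b := ENNReal.ofReal C) (.inr ENNReal.ofReal_ne_top)
  simpa [Function.comp_def] using h3

lemma HSpace.coe_sub {α : ℝ} (u v : HSpace α) :
    ((u - v).1 : Plane →ₘ[volume] ℝ) =ᵐ[volume]
      fun y => (u.1 : Plane →ₘ[volume] ℝ) y - (v.1 : Plane →ₘ[volume] ℝ) y :=
  AEEqFun.coeFn_sub _ _

/-- A Cauchy sequence of `H_α` that converges almost everywhere converges in `L²` on every disc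
(Fatou's lemma, applied to the differences of two members of the sequence). -/
lemma HSpace.tendsto_lintegral_ball {α : ℝ} (hα : 2 ≤ α) {u : ℕ → HSpace α} (hu : CauchySeq u)
    {u₀ : Plane → ℝ}
    (h : ∀ᵐ y, Tendsto (fun n => ((u n).1 : Plane →ₘ[volume] ℝ) y) atTop (𝓝 (u₀ y))) (R : ℝ) :
    Tendsto (fun n => ∫⁻ y in ball 0 R, ‖((u n).1 : Plane →ₘ[volume] ℝ) y - u₀ y‖ₑ ^ 2) atTop
      (𝓝 0) := by
  obtain ⟨K, hK0, hK⟩ := HSpace.exists_lintegral_ball_le hα R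
  rw [ENNReal.tendsto_atTop_zero]
  intro ε hε
  obtain ⟨δ, hδ, hδε⟩ : ∃ δ > 0, ENNReal.ofReal (K * δ ^ 2) ≤ ε := by
    have h1 : Tendsto (fun δ : ℝ => ENNReal.ofReal (K * δ ^ 2)) (𝓝[>] 0) (𝓝 0) := by
      have : Continuous fun δ : ℝ => ENNReal.ofReal (K * δ ^ 2) :=
        ENNReal.continuous_ofReal.comp (by fun_prop)
      simpa using (this.tendsto 0).mono_left nhdsWithin_le_nhds
    obtain ⟨δ, h2, h3⟩ := ((h1.eventually_le_const hε).and self_mem_nhdsWithin).exists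
    exact ⟨δ, h3, h2⟩
  obtain ⟨N, hN⟩ := Metric.cauchySeq_iff.1 hu δ hδ
  refine ⟨N, fun n hn => ?_⟩
  have hlim : ∀ᵐ y, ‖((u n).1 : Plane →ₘ[volume] ℝ) y - u₀ y‖ₑ ^ 2 = liminf (fun m =>
      ‖((u n).1 : Plane →ₘ[volume] ℝ) y - ((u m).1 : Plane →ₘ[volume] ℝ) y‖ₑ ^ 2) atTop := by
    filter_upwards [h] with y hy
    exact (((ENNReal.continuous_pow 2).tendsto _).comp
      (tendsto_const_nhds.sub hy).enorm).liminf_eq.symm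
  calc _ = ∫⁻ y in ball 0 R, liminf (fun m => ‖((u n).1 : Plane →ₘ[volume] ℝ) y -
          ((u m).1 : Plane →ₘ[volume] ℝ) y‖ₑ ^ 2) atTop :=
        lintegral_congr_ae (ae_restrict_of_ae hlim)
    _ ≤ liminf (fun m => ∫⁻ y in ball 0 R, ‖((u n).1 : Plane →ₘ[volume] ℝ) y -
          ((u m).1 : Plane →ₘ[volume] ℝ) y‖ₑ ^ 2) atTop :=
        lintegral_liminf_le fun m =>
          ((HSpace.measurable_coe (u n)).sub (HSpace.measurable_coe (u m))).enorm.pow_const 2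
    _ ≤ ε := by
        refine liminf_le_of_frequently_le' (Eventually.frequently ?_)
        filter_upwards [eventually_ge_atTop N] with m hm
        refine le_trans (le_of_eq_of_le (lintegral_congr_ae (ae_restrict_of_ae ?_))
          (hK (u n - u m))) (le_trans ?_ hδε)
        · filter_upwards [HSpace.coe_sub (u n) (u m)] with y hy
          rw [hy]
        · have := hN n hn m hm
          rw [dist_eq_norm] at this
          gcongr

lemma memL2Loc_of_tendsto {u : ℕ → Plane → ℝ} {u₀ : Plane → ℝ} (hu : ∀ n, MemL2Loc (u n))
    (hu₀ : AEStronglyMeasurable u₀ volume)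
    (h : ∀ R, Tendsto (fun n => ∫⁻ y in ball 0 R, ‖u n y - u₀ y‖ₑ ^ 2) atTop (𝓝 0)) :
    MemL2Loc u₀ := by
  intro K hK
  obtain ⟨R, hR⟩ := hK.isBounded.subset_ball 0
  have h1 : MemLp u₀ 2 (volume.restrict (ball 0 R)) := by
    obtain ⟨n, hn⟩ := ((h R).eventually_lt_const zero_lt_one).exists
    rw [lintegral_enorm_sq (volume.restrict (ball 0 R)) fun y => u n y - u₀ y] at hn
    have hun : MemLp (u n) 2 (volume.restrict (ball 0 R)) :=
      (hu n _ (isCompact_closedBall 0 R)).mono_measure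
        (Measure.restrict_mono ball_subset_closedBall le_rfl)
    have hd : MemLp (fun y => u n y - u₀ y) 2 (volume.restrict (ball 0 R)) := by
      refine ⟨(hun.1.sub hu₀.restrict), lt_top_iff_ne_top.2 fun ht => ?_⟩
      rw [ht] at hn
      simp at hn
    have := hun.sub hd
    refine this.ae_eq (.of_forall fun y => ?_)
    simp
  exact h1.mono_measure (Measure.restrict_mono hR le_rfl)

lemma isWeakGradient_of_tendsto {u : ℕ → Plane → ℝ} {u₀ : Plane → ℝ} {g : ℕ → Plane → Plane}
    {g₀ : Plane → Plane} (hu : ∀ n, MemL2Loc (u n)) (hg : ∀ n, MemL2Loc (g n))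
    (hu₀ : MemL2Loc u₀) (hg₀ : MemL2Loc g₀) (hw : ∀ n, IsWeakGradient (u n) (g n))
    (h : ∀ R, Tendsto (fun n => ∫⁻ y in ball 0 R, ‖u n y - u₀ y‖ₑ ^ 2) atTop (𝓝 0))
    (h' : ∀ R, Tendsto (fun n => ∫⁻ y in ball 0 R, ‖g n y - g₀ y‖ₑ ^ 2) atTop (𝓝 0)) :
    IsWeakGradient u₀ g₀ := by
  intro φ hφ hc i
  obtain ⟨R, hR⟩ := hc.isBounded.subset_ball 0
  have h1 := tendsto_integral_mul_of_tendsto_L2_ball hu hu₀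
    ((hφ.continuous_fderiv (by simp)).clm_apply (continuous_const (y := EuclideanSpace.single i 1)))
    (hc.fderiv_apply ℝ _) ((tsupport_fderiv_apply_subset ℝ _).trans hR) (h R)
  have h2 := tendsto_integral_mul_of_tendsto_L2_ball (fun n => (hg n).coord i) (hg₀.coord i)
    hφ.continuous hc hR (tendsto_of_tendsto_of_tendsto_of_le_of_le tendsto_const_nhds (h' R)
      (fun _ => zero_le) fun n => lintegral_mono fun y => by
        gcongr
        exact enorm_le_iff_norm_le.2 (PiLp.norm_apply_le (g n y - g₀ y) i))
  refine tendsto_nhds_unique h1 ?_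
  simpa only [fun n => hw n φ hφ hc i] using h2.neg

lemma HSpace.exists_toL2_eq_of_tendsto {α : ℝ} (hα : 2 ≤ α) {u : ℕ → HSpace α} (hu : CauchySeq u)
    {f : Plane → ℝ} {g : Plane → Plane} (hf : MemLp f 2 volume) (hg : MemLp g 2 volume)
    (hae : ∀ᵐ y, Tendsto (fun n => weighted α (u n).1 y) atTop (𝓝 (f y)))
    (hgrad : Tendsto (fun n => ∫⁻ y, ‖weakGradient (u n).1 y - g y‖ₑ ^ 2) atTop (𝓝 0)) :
    ∃ U : HSpace α, weakGradient U.1 =ᵐ[volume] g ∧ weighted α U.1 =ᵐ[volume] f := by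
  -- the weight vanishes at most at the origin, so division recovers the limit almost everywhere
  set u₀ : Plane → ℝ := fun y => f y / weight α y with hu₀
  have h0 : ∀ᵐ y ∂(volume : Measure Plane), y ≠ 0 := by simp [ae_iff]
  have hu₀m : AEStronglyMeasurable u₀ volume :=
    (hf.1.aemeasurable.div (measurable_weight α).aemeasurable).aestronglyMeasurable
  have haeu : ∀ᵐ y, Tendsto (fun n => ((u n).1 : Plane →ₘ[volume] ℝ) y) atTop (𝓝 (u₀ y)) := by
    filter_upwards [hae, h0] with y hy hy0
    refine (hy.div_const (weight α y)).congr fun n => ?_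
    exact mul_div_cancel_left₀ _ (weight_pos α hy0).ne'
  have hball := HSpace.tendsto_lintegral_ball hα hu haeu
  have hL2 : ∀ n, MemL2Loc ((u n).1 : Plane →ₘ[volume] ℝ) := fun n => (u n).1.2.1
  have hu₀L : MemL2Loc u₀ := memL2Loc_of_tendsto hL2 hu₀m hball
  have hgL : MemL2Loc g := fun K _ => hg.mono_measure Measure.restrict_le_self
  have hweak : IsWeakGradient u₀ g := isWeakGradient_of_tendsto hL2
    (fun n => memL2Loc_weakGradient (u n).1) hu₀L hgL
    (fun n => isWeakGradient_weakGradient (u n).1) hball fun R =>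
      tendsto_of_tendsto_of_tendsto_of_le_of_le tendsto_const_nhds hgrad (fun _ => zero_le)
        fun n => setLIntegral_le_lintegral _ _
  have hUu : AEEqFun.mk u₀ hu₀m =ᵐ[volume] u₀ := AEEqFun.coeFn_mk _ _
  have hGg : AEEqFun.mk g hg.1 =ᵐ[volume] g := AEEqFun.coeFn_mk _ _
  let W : W12Loc := ⟨AEEqFun.mk u₀ hu₀m, hu₀L.congr_ae hUu.symm, AEEqFun.mk g hg.1,
    hgL.congr_ae hGg.symm, hweak.congr_ae hUu.symm hGg.symm⟩
  have hWg : weakGradient W =ᵐ[volume] g :=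
    weakGradient_eq W hgL (hweak.congr_ae hUu.symm .rfl)
  have hWf : weighted α W =ᵐ[volume] f := by
    filter_upwards [hUu, h0] with y hy hy0
    change weight α y * AEEqFun.mk u₀ hu₀m y = f y
    rw [hy]
    exact mul_div_cancel₀ _ (weight_pos α hy0).ne'
  exact ⟨⟨W, hg.ae_eq hWg.symm, hf.ae_eq hWf.symm⟩, hWg, hWf⟩

lemma HSpace.isometry_toL2 (α : ℝ) : Isometry (HSpace.toL2 α) :=
  AddMonoidHomClass.isometry_of_norm _ fun _ => rfl

/-- `H_α` is complete: its isometric copy in `L²(ℝ²; ℝ²) ⊕ L²(ℝ²)` is closed. -/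
theorem HSpace.isClosed_range_toL2 {α : ℝ} (hα : 2 ≤ α) :
    IsClosed (LinearMap.range (HSpace.toL2 α) : Set (WithLp 2
      (Lp Plane 2 (volume : Measure Plane) × Lp ℝ 2 (volume : Measure Plane)))) := by
  refine isClosed_of_closure_subset fun x hx => ?_
  obtain ⟨z, hz, hzx⟩ := mem_closure_iff_seq_limit.1 hx
  choose v hv using hz
  have hcont1 : Continuous fun x : WithLp 2 (Lp Plane 2 (volume : Measure Plane) ×
      Lp ℝ 2 (volume : Measure Plane)) => x.fst :=
    (WithLp.fstL 2 ℝ (Lp Plane 2 (volume : Measure Plane))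
      (Lp ℝ 2 (volume : Measure Plane))).continuous
  have hcont2 : Continuous fun x : WithLp 2 (Lp Plane 2 (volume : Measure Plane) ×
      Lp ℝ 2 (volume : Measure Plane)) => x.snd :=
    (WithLp.sndL 2 ℝ (Lp Plane 2 (volume : Measure Plane))
      (Lp ℝ 2 (volume : Measure Plane))).continuous
  -- pass to a subsequence along which the weighted functions converge almost everywhere
  obtain ⟨ns, hns, hae⟩ := (tendstoInMeasure_of_tendsto_Lp
    ((hcont2.tendsto x).comp hzx)).exists_seq_tendsto_ae
  have hzx' : Tendsto (fun n => z (ns n)) atTop (𝓝 x) := hzx.comp hns.tendsto_atTop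
  have hcau : CauchySeq fun n => v (ns n) := by
    have h := hzx'.cauchySeq
    rw [Metric.cauchySeq_iff] at h ⊢
    simpa only [← hv, (HSpace.isometry_toL2 α).dist_eq] using h
  have hwe : ∀ n, (z n).snd =ᵐ[volume] weighted α (v n).1 := fun n => by
    rw [← hv n]; exact MemLp.coeFn_toLp (v n).2.2
  have hge : ∀ n, (z n).fst =ᵐ[volume] weakGradient (v n).1 := fun n => by
    rw [← hv n]; exact MemLp.coeFn_toLp (v n).2.1
  have hae' : ∀ᵐ y, Tendsto (fun n => weighted α (v (ns n)).1 y) atTop (𝓝 (x.snd y)) := by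
    filter_upwards [hae, ae_all_iff.2 hwe] with y hy hyw
    exact hy.congr fun n => hyw (ns n)
  have hgrad : Tendsto (fun n => ∫⁻ y, ‖weakGradient (v (ns n)).1 y - x.fst y‖ₑ ^ 2) atTop
      (𝓝 0) := by
    have h1 := (hcont1.tendsto x).comp hzx'
    rw [Lp.tendsto_Lp_iff_tendsto_eLpNorm'] at h1
    have h2 := ((ENNReal.continuous_pow 2).tendsto _).comp h1
    rw [zero_pow two_ne_zero] at h2
    refine h2.congr fun n => ?_
    simp only [Function.comp_apply]
    rw [← lintegral_enorm_sq]
    refine lintegral_congr_ae ?_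
    filter_upwards [hge (ns n)] with y hy
    rw [← hy]
    rfl
  obtain ⟨U, hUg, hUf⟩ := HSpace.exists_toL2_eq_of_tendsto hα hcau (Lp.memLp x.snd)
    (Lp.memLp x.fst) hae' hgrad
  refine ⟨U, WithLp.ofLp_injective 2 (Prod.ext ?_ ?_)⟩
  · exact Lp.ext ((MemLp.coeFn_toLp U.2.1).trans hUg)
  · exact Lp.ext ((MemLp.coeFn_toLp U.2.2).trans hUf)

/-! ### Compactness of the image of the unit ball -/

/-- The closed balls of a Hilbert space are weakly compact and `T` is weakly continuous, so the image of
a ball is weakly compact, hence weakly closed, hence closed. -/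
theorem isClosed_image_closedBall {E F : Type*} [NormedAddCommGroup E] [InnerProductSpace ℝ E]
    [CompleteSpace E] [NormedAddCommGroup F] [NormedSpace ℝ F] (T : E →L[ℝ] F) (r : ℝ) :
    IsClosed (T '' closedBall 0 r) := by
  let S : WeakDual ℝ E → WeakSpace ℝ F := fun x =>
    toWeakSpace ℝ F (T ((InnerProductSpace.toDual ℝ E).symm (WeakDual.toStrongDual x)))
  have hS : Continuous S := by
    refine WeakBilin.continuous_of_continuous_eval _ fun f => ?_
    -- by Riesz, `f ∘ T` is evaluation at a vector of `E`
    have : ∀ x : WeakDual ℝ E, f (T ((InnerProductSpace.toDual ℝ E).symm (WeakDual.toStrongDual x)))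
        = x ((InnerProductSpace.toDual ℝ E).symm (f.comp T)) := by
      intro x
      have h1 := InnerProductSpace.toDual_symm_apply (𝕜 := ℝ) (x :=
        (InnerProductSpace.toDual ℝ E).symm (WeakDual.toStrongDual x)) (y := f.comp T)
      have h2 := InnerProductSpace.toDual_symm_apply (𝕜 := ℝ) (x :=
        (InnerProductSpace.toDual ℝ E).symm (f.comp T)) (y := WeakDual.toStrongDual x)
      rw [real_inner_comm] at h1
      exact h1.symm.trans h2
    refine (WeakDual.eval_continuous ((InnerProductSpace.toDual ℝ E).symm (f.comp T))).congr
      fun x => (this x).symm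
  have hK : IsCompact (S '' (WeakDual.toStrongDual ⁻¹' closedBall 0 r)) :=
    (WeakDual.isCompact_closedBall 0 r).image hS
  have hc : IsClosed (toWeakSpaceCLM ℝ F ⁻¹' (S '' (WeakDual.toStrongDual ⁻¹' closedBall 0 r))) :=
    hK.isClosed.preimage (toWeakSpaceCLM ℝ F).continuous
  convert hc using 1
  ext y
  constructor
  · rintro ⟨u, hu, rfl⟩
    refine ⟨StrongDual.toWeakDual (InnerProductSpace.toDual ℝ E u), ?_, ?_⟩
    · simpa using hu
    · simp [S]
  · rintro ⟨x, hx, hxy⟩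
    refine ⟨(InnerProductSpace.toDual ℝ E).symm (WeakDual.toStrongDual x), ?_, ?_⟩
    · simpa using hx
    · exact (toWeakSpace ℝ F).injective hxy

lemma LSpace.isometry_toL2 (α : ℝ) : Isometry (LSpace.toL2 α) :=
  AddMonoidHomClass.isometry_of_norm _ fun _ => rfl

/-- The space `L_α` itself is not complete, so total boundedness of the image of the unit ball does
not suffice for compactness: the image has to be closed in `L²(ℝ²)`. -/
theorem isClosed_toL2_embedding_image {α : ℝ} (hα : 2 ≤ α) :
    IsClosed (LSpace.toL2 α '' (embedding α '' closedBall 0 1)) := by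
  let S := LinearMap.range (HSpace.toL2 α)
  have : CompleteSpace S := (HSpace.isClosed_range_toL2 hα).completeSpace_coe
  let T : S →L[ℝ] Lp ℝ 2 (volume : Measure Plane) :=
    (WithLp.sndL 2 ℝ (Lp Plane 2 (volume : Measure Plane))
      (Lp ℝ 2 (volume : Measure Plane))).comp S.subtypeL
  convert isClosed_image_closedBall T 1 using 1
  ext f
  constructor
  · rintro ⟨_, ⟨u, hu, rfl⟩, rfl⟩
    refine ⟨⟨HSpace.toL2 α u, u, rfl⟩, ?_, rfl⟩
    rw [mem_closedBall_zero_iff] at hu ⊢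
    exact hu
  · rintro ⟨⟨_, u, rfl⟩, hu, rfl⟩
    refine ⟨_, ⟨u, ?_, rfl⟩, rfl⟩
    rw [mem_closedBall_zero_iff] at hu ⊢
    exact hu

theorem isCompact_embedding_image {α : ℝ} (hα : 2 ≤ α) :
    IsCompact (embedding α '' closedBall 0 1) := by
  rw [(LSpace.isometry_toL2 α).isEmbedding.isInducing.isCompact_iff]
  exact isCompact_iff_totallyBounded_isComplete.2
    ⟨(totallyBounded_embedding_image hα).image (LSpace.isometry_toL2 α).uniformContinuous,
      (isClosed_toL2_embedding_image hα).isComplete⟩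

end WeightedSobolev

theorem proposition5p2 (α : ℝ) (hα : 2 ≤ α) :
    IsCompactOperator (WeightedSobolev.embedding α) := by
  rw [isCompactOperator_iff_exists_mem_nhds_image_subset_compact]
  exact ⟨_, Metric.closedBall_mem_nhds 0 one_pos, _,
    WeightedSobolev.isCompact_embedding_image hα, subset_rfl⟩
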